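/- **Setting.** Let $(n_k,p_k)_{k\ge 1}$ be a sequence of pairs of natural numbers with $n_k,p_k\to\infty$ and $n_k/p_k\to\gamma\in(0,\infty)$, where $(n_k)$ or $(p_k)$ is strictly increasing. For each $k$ let $P_k$ be a probability distribution on $\mathbb R^{d_k}\times\mathbb R$ and $\phi_k:\mathbb R^{d_k}\to\mathbb R^{p_k}$ a measurable feature map with square-integrable components and positive definite covariance $\Sigma_k=\mathbb E_x[\phi_k(x)\phi_k(x)^{\mathsf T}]$. Let $\mathcal D_k=((x_i^{(k)},y_i^{(k)}))_{i\le n_k}\sim P_k^{n_k}$ be training sets on a common probability space, with arbitrary dependence between different $k$. Let $\Phi_k$ be the $n_k\times p_k$ matrix with rows $\phi_k(x_i^{(k)})^{\mathsf T}$, $W_k=\Phi_k\Sigma_k^{-1/2}$ and $G_k=\frac1{p_k}W_kW_k^{\mathsf T}$. For a predictor $f$ put $R_k(f)=\mathbb E_{(x,y)\sim P_k}(y-f(x))^2$, $\mathcal E_k(f)=R_k(f)-R_k(f_\star)$ with $f_\star(x)=\mathbb E(y\mid x)$, and $\widehat R_k(f)=\frac1{n_k}\sum_i(y_i^{(k)}-f(x_i^{(k)}))^2$.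 The minimal excess loss is the random variable $$\mathcal E_\star(\tau;n_k,p_k)=\min\{\mathcal E_k(\beta^{\mathsf T}\phi_k)\;:\;\beta\in\mathbb R^{p_k},\ \widehat R_k(\beta^{\mathsf T}\phi_k)\le\tau\sigma^2\}$$ ($+\infty$ if the constraint is infeasible). **Assumptions.** - [MP] Almost surely, the empirical spectral distribution of $G_k$ converges weakly to the Marchenko–Pastur law $$\mathsf{MP}(\gamma)=\Big(1-\frac1\gamma\Big)_+\delta_0+\frac{\sqrt{(b-x)(x-a)}}{2\pi\gamma x}\mathbf 1_{[a,b]}(x)\,dx,\qquad a=(1-\sqrt\gamma)^2,\ b=(1+\sqrt\gamma)^2 .$$ - [Lin] For every $k$, under $P_k$, $y=\beta_{\star,k}^{\mathsf T}\phi_k(x)+\varepsilon$ for some $\beta_{\star,k}\in\mathbb R^{p_k}$, where $\varepsilon$ is independent of $x$ and has a law not depending on $k$, with $\mathbb E\varepsilon=0$, $\mathbb E\varepsilon^2=\sigma^2$ and $\mathbb E|\varepsilon|^{4+\eta}<\infty$ for some $\eta>0$. Let $m(z;\gamma)=\int\frac{1}{s-z}\,d\mathsf{MP}_\gamma(s)$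 for $z<0$, and let $m'$ be its derivative in $z$. **Proposition (MP asymptotics).** If $\max(0,1-1/\gamma)<\tau<1$, there is exactly one $\lambda>0$ with $$\lambda^2m'(-\lambda;\gamma)=\tau .$$ Moreover, for every $\tau\in\mathbb R$ and every $\lambda>0$ that satisfies this equation, almost surely: the minimum defining $\mathcal E_\star(\tau;n_k,p_k)$ is attained (in particular the constraint is feasible) for all large $k$, and $$\lim_{k\to\infty}\mathcal E_\star(\tau;n_k,p_k)=\sigma^2\gamma\,[\,m(-\lambda;\gamma)-\lambda\,m'(-\lambda;\gamma)\,].$$ -/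

import Mathlib

open MeasureTheory ProbabilityTheory Filter Topology Matrix
open scoped ENNReal BoundedContinuousFunction MatrixOrder

namespace Overfit

noncomputable section

/-! ### Regression: risk, regression function, excess loss -/

/-- Expected (test) loss `R(f) = E_{(x,y) ~ P} (y - f x)^2`. -/
def risk {X : Type*} [MeasurableSpace X] (P : Measure (X × ℝ)) (f : X → ℝ) : ℝ :=
  ∫ z, (z.2 - f z.1) ^ 2 ∂P

/-- The regression function `x ↦ E(y | x)`: the mean of the regular conditional law of `y`
given `x` under `P`. -/
def regressionFunction {X : Type*} [MeasurableSpace X] (P : Measure (X × ℝ))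
    [IsFiniteMeasure P] (x : X) : ℝ :=
  ∫ y, y ∂(P.condKernel x)

/-- Excess loss of a predictor over the regression function. -/
def excessLoss {X : Type*} [MeasurableSpace X] (P : Measure (X × ℝ))
    [IsFiniteMeasure P] (f : X → ℝ) : ℝ :=
  risk P f - risk P (regressionFunction P)

/-- Training (empirical) loss of `f` on the data set `D = ((x_i, y_i))_i`. -/
def trainLoss {X : Type*} {n : ℕ} (D : Fin n → X × ℝ) (f : X → ℝ) : ℝ :=
  (1 / (n : ℝ)) * ∑ i, ((D i).2 - f (D i).1) ^ 2

/-- The linear feature model `x ↦ bᵀ φ(x)`. -/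
def linPred {X : Type*} {p : ℕ} (φ : X → Fin p → ℝ) (b : Fin p → ℝ) : X → ℝ :=
  fun x => b ⬝ᵥ φ x

/-- Coefficient vectors whose training loss is at most `τ σ²`. -/
def feasible {X : Type*} {n p : ℕ} (φ : X → Fin p → ℝ) (σ τ : ℝ) (D : Fin n → X × ℝ) :
    Set (Fin p → ℝ) :=
  {b | trainLoss D (linPred φ b) ≤ τ * σ ^ 2}

/-- Minimal excess loss of a linear feature model under the training constraint; it is `⊤`
when the constraint is infeasible. -/
def minExcessLoss {X : Type*} [MeasurableSpace X] {n p : ℕ} (P : Measure (X × ℝ))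
    [IsFiniteMeasure P] (φ : X → Fin p → ℝ) (σ τ : ℝ) (D : Fin n → X × ℝ) : EReal :=
  ⨅ b ∈ feasible φ σ τ D, ((excessLoss P (linPred φ b) : ℝ) : EReal)

/-- Linear model with additive noise of law `ν`: `y = bᵀ φ(x) + ε` for some vector `b`, where
`ε ~ ν` is independent of `x`. -/
def IsLinearModel {X : Type*} [MeasurableSpace X] {p : ℕ} (P : Measure (X × ℝ))
    (φ : X → Fin p → ℝ) (ν : Measure ℝ) : Prop :=
  ∃ b : Fin p → ℝ, P = (P.fst.prod ν).map (fun z => (z.1, linPred φ b z.1 + z.2))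

/-! ### Whitened Gram matrix and its empirical spectral distribution -/

/-- Feature covariance `Σ = E_x[φ(x) φ(x)ᵀ]`; here `Q` is the law of `x`. -/
def featureCov {X : Type*} [MeasurableSpace X] {p : ℕ} (Q : Measure X) (φ : X → Fin p → ℝ) :
    Matrix (Fin p) (Fin p) ℝ :=
  Matrix.of fun i j => ∫ x, φ x i * φ x j ∂Q

/-- Feature matrix, with rows `φ(x_i)`. -/
def featureMatrix {X : Type*} {n p : ℕ} (φ : X → Fin p → ℝ) (D : Fin n → X × ℝ) :
    Matrix (Fin n) (Fin p) ℝ :=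
  Matrix.of fun i j => φ (D i).1 j

/-- Whitened feature matrix `W = Φ Σ^{-1/2}`. -/
def whitened {X : Type*} [MeasurableSpace X] {n p : ℕ} (Q : Measure X) (φ : X → Fin p → ℝ)
    (D : Fin n → X × ℝ) : Matrix (Fin n) (Fin p) ℝ :=
  featureMatrix φ D * (CFC.sqrt (featureCov Q φ))⁻¹

/-- Whitened Gram matrix `G = W Wᵀ / p`. -/
def gram {X : Type*} [MeasurableSpace X] {n p : ℕ} (Q : Measure X) (φ : X → Fin p → ℝ)
    (D : Fin n → X × ℝ) : Matrix (Fin n) (Fin n) ℝ :=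
  (1 / (p : ℝ)) • (whitened Q φ D * (whitened Q φ D)ᵀ)

theorem gram_isHermitian {X : Type*} [MeasurableSpace X] {n p : ℕ} (Q : Measure X)
    (φ : X → Fin p → ℝ) (D : Fin n → X × ℝ) : (gram Q φ D).IsHermitian := by
  unfold gram Matrix.IsHermitian
  simp [Matrix.conjTranspose_eq_transpose_of_trivial, Matrix.transpose_mul]

/-- Empirical spectral distribution of a symmetric matrix. -/
def esd {n : ℕ} {A : Matrix (Fin n) (Fin n) ℝ} (hA : A.IsHermitian) : Measure ℝ :=
  (n : ℝ≥0∞)⁻¹ • ∑ i, Measure.dirac (hA.eigenvalues i)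

/-- Weak convergence of a sequence of finite measures on `ℝ`. -/
def WeaklyConverges (μ : ℕ → Measure ℝ) (μ' : Measure ℝ) : Prop :=
  ∀ f : ℝ →ᵇ ℝ, Tendsto (fun k => ∫ s, f s ∂(μ k)) atTop (𝓝 (∫ s, f s ∂μ'))

/-! ### Marchenko-Pastur law and Stieltjes transform -/

/-- Marchenko-Pastur law with aspect ratio `γ`. -/
def marchenkoPastur (γ : ℝ) : Measure ℝ :=
  ENNReal.ofReal (1 - 1 / γ) • Measure.dirac 0 +
    (volume.restrict (Set.Icc ((1 - √γ) ^ 2) ((1 + √γ) ^ 2))).withDensity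
      (fun x => ENNReal.ofReal
        (1 / (γ * (2 * Real.pi) * x) * √(((1 + √γ) ^ 2 - x) * (x - (1 - √γ) ^ 2))))

/-- Stieltjes transform `m(z; γ) = ∫ 1 / (s - z) dMP_γ(s)`, used at real `z < 0`. -/
def mpStieltjes (γ z : ℝ) : ℝ :=
  ∫ s, 1 / (s - z) ∂(marchenkoPastur γ)

end

end Overfit

open Overfit

/-! Whitening turns the problem into Euclidean geometry. With `θ = Σ^{1/2}(β - β⋆)` the excess loss
is `‖θ‖²` and the training loss is `‖ε - Wθ‖²/n`, so the minimal excess loss is the squared length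
of the shortest `θ` in a closed convex set. Ridge regression solves this exactly: no vector that
fits the noise at least as well as the ridge solution `θ_ρ` is shorter than it (`ridge_optimal`).
With `A = (G + ρ)⁻¹`, both of its losses are quadratic forms in the noise, `ρ² εᵀA²ε / n` and `(εᵀAε
- ρ εᵀA²ε) / p`. Given the inputs, `A` is fixed and `ε` has independent entries, so `εᵀAʲε = σ² tr
Aʲ + o(n)`. Arbitrary dependence between different `k` leaves Borel-Cantelli as the tool, hence
summable tails are needed (`quadForm_tail_bound`). The off-diagonal part and the truncated diagonal
part are controlled by fourth moments, the rest of the diagonal by its variance; the extra `η`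
moments make that last tail summable. Since `[MP]` gives `tr Aʲ / n → ∫ (s + ρ)⁻ʲ dMP`, the two
losses tend to `σ² ρ² m'(-ρ)` and `σ² γ (m(-ρ) - ρ m'(-ρ))` (`ae_tendsto_ridge`). The map `ρ ↦ ρ²
m'(-ρ)` is continuous and strictly increasing from the atom at `0` to `1`, which gives existence and
uniqueness of `λ`. For `ρ < λ` the ridge solution is eventually feasible and bounds the minimum from
above; for `ρ > λ` it eventually fits worse than the constraint and bounds the minimum from below.
Letting `ρ → λ` through countably many values on both sides finishes the proof
(`ae_tendsto_minExcessLoss`). -/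

namespace Overfit

/-! ### Fourth moments of linear and off-diagonal quadratic forms in independent variables -/

section FourthMoments

variable {Ω : Type*} [MeasurableSpace Ω] {μ : Measure Ω}

theorem integral_sq_mul_sq_le {S L : Ω → ℝ} {u l : ℝ} (hS : AEStronglyMeasurable S μ)
    (hL : AEStronglyMeasurable L μ) (hS4 : Integrable (fun ω => S ω ^ 4) μ)
    (hL4 : Integrable (fun ω => L ω ^ 4) μ) (hu : 0 ≤ u) (hl : 0 ≤ l)
    (hSu : ∫ ω, S ω ^ 4 ∂μ ≤ u ^ 2) (hLl : ∫ ω, L ω ^ 4 ∂μ ≤ l ^ 2) :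
    ∫ ω, S ω ^ 2 * L ω ^ 2 ∂μ ≤ u * l := by
  have h2 : ENNReal.ofReal (2 : ℝ) = 2 := by simp
  have key : ∀ {F : Ω → ℝ}, AEStronglyMeasurable F μ → Integrable (fun ω => F ω ^ 4) μ →
      MemLp (fun ω => F ω ^ 2) (ENNReal.ofReal 2) μ := by
    intro F hF hF4
    rw [h2]
    refine (memLp_two_iff_integrable_sq (hF.pow 2)).2 ?_
    simpa [← pow_mul] using hF4
  have h := integral_mul_le_Lp_mul_Lq_of_nonneg (μ := μ) (p := 2) (q := 2)
    (Real.HolderConjugate.two_two) (f := fun ω => S ω ^ 2) (g := fun ω => L ω ^ 2)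
    (Eventually.of_forall fun ω => by positivity) (Eventually.of_forall fun ω => by positivity)
    (key hS hS4) (key hL hL4)
  refine h.trans ?_
  simp only [Real.rpow_two, ← pow_mul, ← Real.sqrt_eq_rpow]
  exact mul_le_mul (Real.sqrt_le_iff.2 ⟨hu, hSu⟩) (Real.sqrt_le_iff.2 ⟨hl, hLl⟩)
    (Real.sqrt_nonneg _) hu

theorem integrable_of_abs_le_pow_four {F S L : Ω → ℝ} (hF : AEStronglyMeasurable F μ)
    (hS4 : Integrable (fun ω => S ω ^ 4) μ) (hL4 : Integrable (fun ω => L ω ^ 4) μ) (C : ℝ)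
    (h : ∀ ω, |F ω| ≤ C * (S ω ^ 4 + L ω ^ 4)) : Integrable F μ :=
  Integrable.mono' ((hS4.add hL4).const_mul C) hF (Eventually.of_forall h)

theorem abs_pow_three_mul_le (a b : ℝ) : |a ^ 3 * b| ≤ 1 * (a ^ 4 + b ^ 4) := by
  rw [abs_le]
  constructor <;> nlinarith [sq_nonneg (a ^ 2 - a * b), sq_nonneg (a ^ 2 + a * b),
    sq_nonneg (a ^ 2 - b ^ 2), sq_nonneg (a ^ 2), sq_nonneg (b ^ 2)]

theorem sq_mul_sq_le_pow_four (a b : ℝ) : |a ^ 2 * b ^ 2| ≤ 1 * (a ^ 4 + b ^ 4) := by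
  rw [abs_of_nonneg (by positivity)]
  nlinarith [sq_nonneg (a ^ 2 - b ^ 2), sq_nonneg (a ^ 2), sq_nonneg (b ^ 2)]

/-- In terms of squared `L⁴` norms: `‖S + X L‖² ≤ ‖S‖² + 4 ‖X‖² ‖L‖²` when `X` is centred and
independent of `(S, L)`. -/
theorem fourth_moment_add_mul_le [IsProbabilityMeasure μ] {X S L : Ω → ℝ} {x u l : ℝ}
    (hX : Measurable X) (hS : Measurable S) (hL : Measurable L)
    (hX4 : Integrable (fun ω => X ω ^ 4) μ) (hS4 : Integrable (fun ω => S ω ^ 4) μ)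
    (hL4 : Integrable (fun ω => L ω ^ 4) μ) (hind : IndepFun X (fun ω => (S ω, L ω)) μ)
    (hX0 : ∫ ω, X ω ∂μ = 0) (hx : 0 ≤ x) (hu : 0 ≤ u) (hl : 0 ≤ l)
    (hXx : ∫ ω, X ω ^ 4 ∂μ ≤ x ^ 2) (hSu : ∫ ω, S ω ^ 4 ∂μ ≤ u ^ 2)
    (hLl : ∫ ω, L ω ^ 4 ∂μ ≤ l ^ 2) :
    Integrable (fun ω => (S ω + X ω * L ω) ^ 4) μ ∧
      ∫ ω, (S ω + X ω * L ω) ^ 4 ∂μ ≤ (u + 4 * x * l) ^ 2 := by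
  have h1 : Integrable (fun _ : Ω => (1 : ℝ) ^ 4) μ := by simp
  have iX : Integrable X μ := integrable_of_abs_le_pow_four hX.aestronglyMeasurable hX4 h1 1
    fun ω => by
      have := abs_pow_three_mul_le 1 (X ω)
      simpa [add_comm] using this
  have iX2 : Integrable (fun ω => X ω ^ 2) μ :=
    integrable_of_abs_le_pow_four (hX.pow_const 2).aestronglyMeasurable hX4 h1 1
    fun ω => by simpa using sq_mul_sq_le_pow_four (X ω) 1
  have iA : Integrable (fun ω => S ω ^ 3 * L ω) μ :=
    integrable_of_abs_le_pow_four (by fun_prop) hS4 hL4 1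
      fun ω => abs_pow_three_mul_le _ _
  have iB : Integrable (fun ω => S ω ^ 2 * L ω ^ 2) μ :=
    integrable_of_abs_le_pow_four (by fun_prop) hS4 hL4 1
      fun ω => sq_mul_sq_le_pow_four _ _
  have indA : IndepFun X (fun ω => S ω ^ 3 * L ω) μ :=
    hind.comp (φ := id) (ψ := fun q : ℝ × ℝ => q.1 ^ 3 * q.2) measurable_id (by fun_prop)
  have indB : IndepFun (fun ω => X ω ^ 2) (fun ω => S ω ^ 2 * L ω ^ 2) μ :=
    hind.comp (φ := fun y : ℝ => y ^ 2) (ψ := fun q : ℝ × ℝ => q.1 ^ 2 * q.2 ^ 2)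
      (by fun_prop) (by fun_prop)
  have indC : IndepFun (fun ω => X ω ^ 4) (fun ω => L ω ^ 4) μ :=
    hind.comp (φ := fun y : ℝ => y ^ 4) (ψ := fun q : ℝ × ℝ => q.2 ^ 4)
      (by fun_prop) (by fun_prop)
  have jA : Integrable (fun ω => X ω * (S ω ^ 3 * L ω)) μ := indA.integrable_mul iX iA
  have jB : Integrable (fun ω => X ω ^ 2 * (S ω ^ 2 * L ω ^ 2)) μ := indB.integrable_mul iX2 iB
  have jC : Integrable (fun ω => X ω ^ 4 * L ω ^ 4) μ := indC.integrable_mul hX4 hL4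
  have eA : ∫ ω, X ω * (S ω ^ 3 * L ω) ∂μ = 0 := by
    rw [indA.integral_fun_mul_eq_mul_integral iX.1 iA.1, hX0, zero_mul]
  have eB : ∫ ω, X ω ^ 2 * (S ω ^ 2 * L ω ^ 2) ∂μ ≤ x * (u * l) := by
    rw [indB.integral_fun_mul_eq_mul_integral iX2.1 iB.1]
    refine mul_le_mul ?_ (integral_sq_mul_sq_le hS.aestronglyMeasurable hL.aestronglyMeasurable hS4 hL4 hu hl hSu hLl) ?_ hx
    · have := integral_sq_mul_sq_le (μ := μ) (S := X) (L := fun _ => 1) (l := 1) iX.1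
        aestronglyMeasurable_const hX4 h1 hx zero_le_one hXx (by simp)
      simpa using this
    · exact integral_nonneg fun ω => by positivity
  have eC : ∫ ω, X ω ^ 4 * L ω ^ 4 ∂μ ≤ x ^ 2 * l ^ 2 := by
    rw [indC.integral_fun_mul_eq_mul_integral hX4.1 hL4.1]
    exact mul_le_mul hXx hLl (integral_nonneg fun ω => by positivity) (sq_nonneg _)
  -- The cubic term `4 S (XL)³` is at most `2 S²(XL)² + 2 (XL)⁴`, so no third moment of `X` enters.
  -- The term linear in `X` integrates to zero, and the remaining `8xul + 3x²l²` fits into the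
  -- square of `u + 4xl`.
  have hbd : ∀ ω, (S ω + X ω * L ω) ^ 4 ≤ S ω ^ 4 + 4 * (X ω * (S ω ^ 3 * L ω)) +
      8 * (X ω ^ 2 * (S ω ^ 2 * L ω ^ 2)) + 3 * (X ω ^ 4 * L ω ^ 4) := by
    intro ω
    nlinarith [sq_nonneg (S ω * (X ω * L ω) - (X ω * L ω) ^ 2)]
  have hint : Integrable (fun ω => S ω ^ 4 + 4 * (X ω * (S ω ^ 3 * L ω)) +
      8 * (X ω ^ 2 * (S ω ^ 2 * L ω ^ 2)) + 3 * (X ω ^ 4 * L ω ^ 4)) μ :=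
    ((hS4.add (jA.const_mul 4)).add (jB.const_mul 8)).add (jC.const_mul 3)
  have hi : Integrable (fun ω => (S ω + X ω * L ω) ^ 4) μ :=
    hint.mono' (by fun_prop) (Eventually.of_forall fun ω => by
      rw [Real.norm_of_nonneg (by positivity)]; exact hbd ω)
  refine ⟨hi, (integral_mono hi hint hbd).trans ?_⟩
  have e : ∫ ω, S ω ^ 4 + 4 * (X ω * (S ω ^ 3 * L ω)) + 8 * (X ω ^ 2 * (S ω ^ 2 * L ω ^ 2)) +
      3 * (X ω ^ 4 * L ω ^ 4) ∂μ = ∫ ω, S ω ^ 4 ∂μ + 4 * ∫ ω, X ω * (S ω ^ 3 * L ω) ∂μ +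
      8 * ∫ ω, X ω ^ 2 * (S ω ^ 2 * L ω ^ 2) ∂μ + 3 * ∫ ω, X ω ^ 4 * L ω ^ 4 ∂μ := by
    have k1 : Integrable (fun ω => S ω ^ 4 + 4 * (X ω * (S ω ^ 3 * L ω))) μ :=
      hS4.add (jA.const_mul 4)
    have k2 : Integrable (fun ω => S ω ^ 4 + 4 * (X ω * (S ω ^ 3 * L ω)) +
      8 * (X ω ^ 2 * (S ω ^ 2 * L ω ^ 2))) μ := k1.add (jB.const_mul 8)
    rw [integral_add k2 (jC.const_mul 3), integral_add k1 (jB.const_mul 8),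
      integral_add hS4 (jA.const_mul 4), integral_const_mul, integral_const_mul,
      integral_const_mul]
  rw [e, eA]
  nlinarith [sq_nonneg (x * l)]

variable {ι : Type*} [IsProbabilityMeasure μ]

/-- Variables are added one at a time with `L` the constant `c a`, so the bound on the squared `L⁴`
norm grows by `4x (c a)²` per step. -/
theorem fourth_moment_linear_form_le {ξ : ι → Ω → ℝ} (hξ : ∀ i, Measurable (ξ i))
    (hind : iIndepFun ξ μ) (h0 : ∀ i, ∫ ω, ξ i ω ∂μ = 0)
    (h4 : ∀ i, Integrable (fun ω => ξ i ω ^ 4) μ) {x : ℝ} (hx : 0 ≤ x)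
    (hle : ∀ i, ∫ ω, ξ i ω ^ 4 ∂μ ≤ x ^ 2) (c : ι → ℝ) (s : Finset ι) :
    Integrable (fun ω => (∑ i ∈ s, c i * ξ i ω) ^ 4) μ ∧
      ∫ ω, (∑ i ∈ s, c i * ξ i ω) ^ 4 ∂μ ≤ (4 * x * ∑ i ∈ s, c i ^ 2) ^ 2 := by
  classical
  induction s using Finset.induction_on with
  | empty => simp
  | insert a s ha ih =>
    have hI : IndepFun (ξ a) (fun ω => (∑ i ∈ s, c i * ξ i ω, c a)) μ := by
      have hev : Measurable fun y : ({a} : Finset ι) → ℝ => y ⟨a, Finset.mem_singleton_self a⟩ :=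
        measurable_pi_apply _
      have := (hind.indepFun_finset {a} s (by simpa using ha) hξ).comp
        (ψ := fun y : s → ℝ => (∑ i : s, c i * y i, c a)) hev (by fun_prop)
      have e : ∀ ω, ∑ i : s, c i * ξ i ω = ∑ i ∈ s, c i * ξ i ω :=
        fun ω => Finset.sum_coe_sort s fun i => c i * ξ i ω
      simpa only [Function.comp_def, e] using this
    have := fourth_moment_add_mul_le (hξ a) (Finset.measurable_fun_sum s fun i _ => (hξ i).const_mul (c i))
      measurable_const (h4 a) ih.1 (by simp) hI (h0 a) hx (u := 4 * x * ∑ i ∈ s, c i ^ 2)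
      (l := c a ^ 2) (by positivity) (by positivity) (hle a) ih.2
      (by simp [← pow_mul])
    have e : ∀ ω, ∑ i ∈ insert a s, c i * ξ i ω = ∑ i ∈ s, c i * ξ i ω + ξ a ω * c a := fun ω => by
      rw [Finset.sum_insert ha]; ring
    simp only [e]
    refine ⟨this.1, this.2.trans_eq ?_⟩
    rw [Finset.sum_insert ha]
    ring

/-- With zero diagonal, a new index `a` adds `ξ a` times a linear form in the earlier variables,
which is independent of `ξ a`. This martingale structure reduces each step to
`fourth_moment_add_mul_le`. -/
theorem fourth_moment_offDiag_form_le {ξ : ι → Ω → ℝ} (hξ : ∀ i, Measurable (ξ i))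
    (hind : iIndepFun ξ μ) (h0 : ∀ i, ∫ ω, ξ i ω ∂μ = 0)
    (h4 : ∀ i, Integrable (fun ω => ξ i ω ^ 4) μ) {x : ℝ} (hx : 0 ≤ x)
    (hle : ∀ i, ∫ ω, ξ i ω ^ 4 ∂μ ≤ x ^ 2) (A : ι → ι → ℝ) (hA : ∀ i, A i i = 0)
    (s : Finset ι) :
    Integrable (fun ω => (∑ i ∈ s, ∑ j ∈ s, A i j * (ξ i ω * ξ j ω)) ^ 4) μ ∧
      ∫ ω, (∑ i ∈ s, ∑ j ∈ s, A i j * (ξ i ω * ξ j ω)) ^ 4 ∂μ ≤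
        (32 * x ^ 2 * ∑ i ∈ s, ∑ j ∈ s, A i j ^ 2) ^ 2 := by
  classical
  induction s using Finset.induction_on with
  | empty => simp
  | insert a s ha ih =>
    have hI : IndepFun (ξ a) (fun ω => (∑ i ∈ s, ∑ j ∈ s, A i j * (ξ i ω * ξ j ω),
        ∑ j ∈ s, (A a j + A j a) * ξ j ω)) μ := by
      have hev : Measurable fun y : ({a} : Finset ι) → ℝ => y ⟨a, Finset.mem_singleton_self a⟩ :=
        measurable_pi_apply _
      have := (hind.indepFun_finset {a} s (by simpa using ha) hξ).comp
        (ψ := fun y : s → ℝ => (∑ i : s, ∑ j : s, A i j * (y i * y j),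
          ∑ j : s, (A a j + A j a) * y j)) hev (by fun_prop)
      have e1 : ∀ ω, ∑ j : s, (A a j + A j a) * ξ j ω = ∑ j ∈ s, (A a j + A j a) * ξ j ω :=
        fun ω => Finset.sum_coe_sort s fun j => (A a j + A j a) * ξ j ω
      have e2 : ∀ i ω, ∑ j : s, A i j * (ξ i ω * ξ j ω) = ∑ j ∈ s, A i j * (ξ i ω * ξ j ω) :=
        fun i ω => Finset.sum_coe_sort s fun j => A i j * (ξ i ω * ξ j ω)
      have e3 : ∀ ω, ∑ i : s, ∑ j ∈ s, A i j * (ξ i ω * ξ j ω) =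
          ∑ i ∈ s, ∑ j ∈ s, A i j * (ξ i ω * ξ j ω) :=
        fun ω => Finset.sum_coe_sort s fun i => ∑ j ∈ s, A i j * (ξ i ω * ξ j ω)
      simpa only [Function.comp_def, e1, e2, e3] using this
    have hlin := fourth_moment_linear_form_le hξ hind h0 h4 hx hle (fun j => A a j + A j a) s
    have := fourth_moment_add_mul_le (hξ a) (by fun_prop) (by fun_prop)
      (h4 a) ih.1 hlin.1 hI (h0 a) hx
      (u := 32 * x ^ 2 * ∑ i ∈ s, ∑ j ∈ s, A i j ^ 2)
      (l := 4 * x * ∑ i ∈ s, (A a i + A i a) ^ 2) (by positivity) (by positivity) (hle a) ih.2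
      hlin.2
    have e : ∀ ω, ∑ i ∈ insert a s, ∑ j ∈ insert a s, A i j * (ξ i ω * ξ j ω) =
        (∑ i ∈ s, ∑ j ∈ s, A i j * (ξ i ω * ξ j ω)) +
          ξ a ω * ∑ j ∈ s, (A a j + A j a) * ξ j ω := by
      intro ω
      have : ∀ j, ξ a ω * ((A a j + A j a) * ξ j ω) =
        A a j * (ξ a ω * ξ j ω) + A j a * (ξ j ω * ξ a ω) := fun j => by ring
      simp only [Finset.sum_insert ha, hA, Finset.mul_sum, this, Finset.sum_add_distrib]
      ring
    simp only [e]
    refine ⟨this.1, this.2.trans ?_⟩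
    -- Each increment carries `4x · 4x = 16x²`; symmetrising the coefficients costs the further
    -- factor 2 in `32x²`.
    have e2 : ∑ i ∈ s, (A a i + A i a) ^ 2 ≤
        2 * (∑ i ∈ s, A a i ^ 2 + ∑ i ∈ s, A i a ^ 2) := by
      rw [← Finset.sum_add_distrib, Finset.mul_sum]
      exact Finset.sum_le_sum fun i _ => by nlinarith [sq_nonneg (A a i - A i a)]
    have e3 : ∑ i ∈ insert a s, ∑ j ∈ insert a s, A i j ^ 2 =
        (∑ i ∈ s, ∑ j ∈ s, A i j ^ 2) + (∑ i ∈ s, A a i ^ 2 + ∑ i ∈ s, A i a ^ 2) := by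
      simp only [Finset.sum_insert ha, hA, Finset.sum_add_distrib]
      ring
    rw [e3]
    refine pow_le_pow_left₀ (by positivity) ?_ 2
    nlinarith [mul_le_mul_of_nonneg_left e2 (sq_nonneg x)]

theorem second_moment_linear_form_le {ξ : ι → Ω → ℝ} (hξ : ∀ i, MemLp (ξ i) 2 μ)
    (hind : iIndepFun ξ μ) (h0 : ∀ i, ∫ ω, ξ i ω ∂μ = 0) {v : ℝ}
    (hle : ∀ i, ∫ ω, ξ i ω ^ 2 ∂μ ≤ v) (c : ι → ℝ) (s : Finset ι) :
    Integrable (fun ω => (∑ i ∈ s, c i * ξ i ω) ^ 2) μ ∧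
    ∫ ω, (∑ i ∈ s, c i * ξ i ω) ^ 2 ∂μ ≤ v * ∑ i ∈ s, c i ^ 2 := by
  have hm : ∀ i, MemLp (fun ω => c i * ξ i ω) 2 μ := fun i => (hξ i).const_mul (c i)
  have hsum : MemLp (fun ω => ∑ i ∈ s, c i * ξ i ω) 2 μ := memLp_finsetSum s fun i _ => hm i
  refine ⟨hsum.integrable_sq, ?_⟩
  have hz : ∀ i, ∫ ω, c i * ξ i ω ∂μ = 0 := fun i => by rw [integral_const_mul, h0, mul_zero]
  have hz' : ∫ ω, ∑ i ∈ s, c i * ξ i ω ∂μ = 0 := by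
    rw [integral_finsetSum _ fun i _ => (hm i).integrable one_le_two]
    simp [hz]
  rw [← variance_of_integral_eq_zero hsum.aemeasurable hz']
  have := IndepFun.variance_sum (X := fun i ω => c i * ξ i ω) (s := s) (μ := μ)
    (fun i _ => hm i) (fun i _ j _ hij => (hind.indepFun hij).comp
      (φ := fun y => c i * y) (ψ := fun y => c j * y) (by fun_prop) (by fun_prop))
  have e : (∑ i ∈ s, fun ω => c i * ξ i ω) = fun ω => ∑ i ∈ s, c i * ξ i ω := by
    ext; simp
  rw [← e, this, Finset.mul_sum]
  refine Finset.sum_le_sum fun i _ => ?_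
  rw [variance_of_integral_eq_zero (hm i).aemeasurable (hz i)]
  simp only [mul_pow]
  rw [integral_const_mul, mul_comm]
  exact mul_le_mul_of_nonneg_right (hle i) (sq_nonneg _)

end FourthMoments

/-! ### Truncation and concentration of quadratic forms in the noise -/

section Concentration

theorem measureReal_abs_ge_le_of_pow_four {Ω : Type*} [MeasurableSpace Ω] {μ : Measure Ω}
    {F : Ω → ℝ} {a B : ℝ} (ha : 0 < a)
    (hF : Integrable (fun ω => F ω ^ 4) μ) (hB : ∫ ω, F ω ^ 4 ∂μ ≤ B) :
    μ.real {ω | a ≤ |F ω|} ≤ B / a ^ 4 := by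
  have h := mul_meas_ge_le_integral_of_nonneg
    (Eventually.of_forall fun ω => show 0 ≤ F ω ^ 4 by positivity) hF (a ^ 4)
  have e : {ω | a ^ 4 ≤ F ω ^ 4} = {ω | a ≤ |F ω|} := by
    ext ω
    simp only [Set.mem_ofPred_eq]
    rw [← Even.pow_abs (by decide : Even 4) (F ω)]
    exact pow_le_pow_iff_left₀ ha.le (abs_nonneg _) (by norm_num)
  rw [e] at h
  rw [le_div_iff₀ (by positivity), mul_comm]
  exact h.trans hB

theorem measureReal_abs_ge_le_of_sq {Ω : Type*} [MeasurableSpace Ω] {μ : Measure Ω}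
    {F : Ω → ℝ} {a B : ℝ} (ha : 0 < a)
    (hF : Integrable (fun ω => F ω ^ 2) μ) (hB : ∫ ω, F ω ^ 2 ∂μ ≤ B) :
    μ.real {ω | a ≤ |F ω|} ≤ B / a ^ 2 := by
  have h := mul_meas_ge_le_integral_of_nonneg
    (Eventually.of_forall fun ω => show 0 ≤ F ω ^ 2 by positivity) hF (a ^ 2)
  have e : {ω | a ^ 2 ≤ F ω ^ 2} = {ω | a ≤ |F ω|} := by
    ext ω
    simp only [Set.mem_ofPred_eq]
    rw [← sq_abs (F ω)]
    exact pow_le_pow_iff_left₀ ha.le (abs_nonneg _) (by norm_num)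
  rw [e] at h
  rw [le_div_iff₀ (by positivity), mul_comm]
  exact h.trans hB

variable {ν : Measure ℝ} [IsProbabilityMeasure ν] {σ η : ℝ}

theorem integrable_pow_four_of_moment (hη : 0 < η)
    (hν : Integrable (fun e : ℝ => |e| ^ (4 + η)) ν) : Integrable (fun e : ℝ => e ^ 4) ν := by
  refine ((integrable_const (1 : ℝ)).add hν).mono' (by fun_prop) (Eventually.of_forall fun e => ?_)
  rw [Real.norm_of_nonneg (by positivity)]
  have h0 : (0 : ℝ) ≤ |e| ^ (4 + η) := by positivity
  show e ^ 4 ≤ 1 + |e| ^ (4 + η)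
  rw [← Even.pow_abs (by decide : Even 4) e]
  rcases le_total |e| 1 with h | h
  · have := pow_le_one₀ (n := 4) (abs_nonneg e) h
    linarith
  · have : |e| ^ (4 : ℝ) ≤ |e| ^ (4 + η) := Real.rpow_le_rpow_of_exponent_le h (by linarith)
    have e4 : |e| ^ (4 : ℝ) = |e| ^ 4 := by exact_mod_cast Real.rpow_natCast |e| 4
    rw [e4] at this
    linarith

theorem integrable_sq_of_pow_four (h4 : Integrable (fun e : ℝ => e ^ 4) ν) :
    Integrable (fun e : ℝ => e ^ 2) ν := by
  refine integrable_of_abs_le_pow_four (by fun_prop) h4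
    (show Integrable (fun _ : ℝ => (1 : ℝ) ^ 4) ν by simp) 1 fun e => ?_
  simpa using sq_mul_sq_le_pow_four e 1

theorem integrable_id_of_pow_four (h4 : Integrable (fun e : ℝ => e ^ 4) ν) :
    Integrable (fun e : ℝ => e) ν := by
  refine integrable_of_abs_le_pow_four (by fun_prop) h4
    (show Integrable (fun _ : ℝ => (1 : ℝ) ^ 4) ν by simp) 1 fun e => ?_
  have := abs_pow_three_mul_le 1 e
  simpa [add_comm] using this

theorem integral_sq_sub_integral_le {Y : ℝ → ℝ} (hY : MemLp Y 2 ν) :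
    ∫ e, (Y e - ∫ e', Y e' ∂ν) ^ 2 ∂ν ≤ ∫ e, Y e ^ 2 ∂ν := by
  rw [← variance_eq_integral hY.aemeasurable]
  exact variance_le_expectation_sq hY.aestronglyMeasurable

/-- Decomposition of the centred squared noise into a bounded part and a part with small variance. -/
theorem exists_truncation (hη : 0 < η)
    (hν_var : ∫ e, e ^ 2 ∂ν = σ ^ 2) (hν : Integrable (fun e : ℝ => |e| ^ (4 + η)) ν)
    {t : ℝ} (ht : 0 < t) (hσt : |σ| ≤ t) :
    ∃ g h : ℝ → ℝ, Measurable g ∧ (∀ e, e ^ 2 - σ ^ 2 = g e + h e) ∧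
      ∫ e, g e ∂ν = 0 ∧ ∫ e, h e ∂ν = 0 ∧ Integrable (fun e => g e ^ 4) ν ∧ MemLp h 2 ν ∧
      ∫ e, g e ^ 4 ∂ν ≤ (2 * t ^ 2 * √(∫ e, (e ^ 2 - σ ^ 2) ^ 2 ∂ν)) ^ 2 ∧
      ∫ e, h e ^ 2 ∂ν ≤ (∫ e, |e| ^ (4 + η) ∂ν) * t ^ (-η) := by
  have h4 := integrable_pow_four_of_moment hη hν
  have h2 := integrable_sq_of_pow_four h4
  have hσ2 : σ ^ 2 ≤ t ^ 2 := by
    rw [← sq_abs σ]; exact pow_le_pow_left₀ (abs_nonneg _) hσt 2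
  have hX2 : MemLp (fun e : ℝ => e ^ 2 - σ ^ 2) 2 ν := by
    refine (memLp_two_iff_integrable_sq (by fun_prop)).2 ?_
    have : (fun e : ℝ => (e ^ 2 - σ ^ 2) ^ 2) = fun e => e ^ 4 - 2 * σ ^ 2 * e ^ 2 + σ ^ 4 := by
      ext e; ring
    rw [this]
    exact (h4.sub (h2.const_mul _)).add (integrable_const _)
  have hs : MeasurableSet {e : ℝ | |e| ≤ t} := measurableSet_le (by fun_prop) (by fun_prop)
  set Y : ℝ → ℝ := {e : ℝ | |e| ≤ t}.indicator fun e => e ^ 2 - σ ^ 2 with hYdef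
  set Z : ℝ → ℝ := {e : ℝ | |e| ≤ t}ᶜ.indicator fun e => e ^ 2 - σ ^ 2 with hZdef
  have hY : MemLp Y 2 ν := hX2.indicator hs
  have hZ : MemLp Z 2 ν := hX2.indicator hs.compl
  have hYm : Measurable Y := Measurable.indicator (by fun_prop) hs
  have hYZ : ∀ e, Y e + Z e = e ^ 2 - σ ^ 2 := fun e => by
    rw [hYdef, hZdef]; exact Set.indicator_self_add_compl_apply _ _ e
  have hYi := hY.integrable one_le_two
  have hZi := hZ.integrable one_le_two
  have hsum : ∫ e, Y e ∂ν + ∫ e, Z e ∂ν = 0 := by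
    rw [← integral_add hYi hZi]
    simp only [hYZ]
    rw [integral_sub h2 (integrable_const _), hν_var]
    simp
  have hYb : ∀ e, |Y e| ≤ t ^ 2 := by
    intro e
    rw [hYdef, Set.indicator_apply]
    split_ifs with he
    · have he2 : e ^ 2 ≤ t ^ 2 := by
        rw [← sq_abs e]; exact pow_le_pow_left₀ (abs_nonneg _) he 2
      rw [abs_le]
      constructor <;> nlinarith [sq_nonneg e, sq_nonneg σ]
    · simp; positivity
  have hEY : |∫ e, Y e ∂ν| ≤ t ^ 2 := by
    have := norm_integral_le_of_norm_le_const (μ := ν) (f := Y) (Eventually.of_forall hYb)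
    simpa using this
  have hgb : ∀ e, |Y e - ∫ e', Y e' ∂ν| ≤ 2 * t ^ 2 := fun e => by
    have := abs_sub (Y e) (∫ e', Y e' ∂ν)
    linarith [hYb e]
  -- Boundedness trades two powers for `4t⁴`, so the fourth moment of the truncated part needs only
  -- the variance of `e²`.
  have hg4 : ∀ e, (Y e - ∫ e', Y e' ∂ν) ^ 4 ≤ 4 * t ^ 4 * (Y e - ∫ e', Y e' ∂ν) ^ 2 := fun e => by
    have : (Y e - ∫ e', Y e' ∂ν) ^ 2 ≤ (2 * t ^ 2) ^ 2 := by
      rw [← sq_abs]; exact pow_le_pow_left₀ (abs_nonneg _) (hgb e) 2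
    nlinarith [sq_nonneg (Y e - ∫ e', Y e' ∂ν)]
  have hYc : MemLp (fun e => Y e - ∫ e', Y e' ∂ν) 2 ν := hY.sub (memLp_const _)
  have hZc : MemLp (fun e => Z e - ∫ e', Z e' ∂ν) 2 ν := hZ.sub (memLp_const _)
  have hg4i : Integrable (fun e => (Y e - ∫ e', Y e' ∂ν) ^ 4) ν :=
    (hYc.integrable_sq.const_mul (4 * t ^ 4)).mono' (by fun_prop)
      (Eventually.of_forall fun e => by rw [Real.norm_of_nonneg (by positivity)]; exact hg4 e)
  refine ⟨fun e => Y e - ∫ e', Y e' ∂ν, fun e => Z e - ∫ e', Z e' ∂ν, by fun_prop, ?_, ?_, ?_,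
    hg4i, hZc, ?_, ?_⟩
  · intro e
    linarith [hYZ e]
  · rw [integral_sub hYi (integrable_const _)]; simp
  · rw [integral_sub hZi (integrable_const _)]; simp
  · rw [mul_pow, Real.sq_sqrt (integral_nonneg fun e => sq_nonneg _)]
    refine (integral_mono hg4i (hYc.integrable_sq.const_mul (4 * t ^ 4)) hg4).trans ?_
    rw [integral_const_mul]
    have e1 : (2 * t ^ 2) ^ 2 = 4 * t ^ 4 := by ring
    rw [e1]
    refine mul_le_mul_of_nonneg_left ((integral_sq_sub_integral_le hY).trans ?_) (by positivity)
    refine integral_mono hY.integrable_sq hX2.integrable_sq fun e => ?_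
    show Y e ^ 2 ≤ (e ^ 2 - σ ^ 2) ^ 2
    rw [hYdef, Set.indicator_apply]
    split_ifs
    · exact le_rfl
    · rw [zero_pow two_ne_zero]; positivity
  · refine (integral_sq_sub_integral_le hZ).trans ?_
    rw [← integral_mul_const]
    refine integral_mono hZ.integrable_sq (hν.mul_const _) fun e => ?_
    show Z e ^ 2 ≤ |e| ^ (4 + η) * t ^ (-η)
    rw [hZdef, Set.indicator_apply]
    split_ifs with he
    · have he' : t < |e| := not_le.1 he
      have he2 : t ^ 2 ≤ e ^ 2 := by
        rw [← sq_abs e]; exact pow_le_pow_left₀ ht.le he'.le 2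
      -- On the tail `σ² ≤ t² ≤ e²`, so the square is at most `e⁴`, and `1 ≤ (|e| / t)^η` supplies
      -- the decay in `t`.
      have hle : (e ^ 2 - σ ^ 2) ^ 2 ≤ e ^ 4 := by nlinarith [sq_nonneg σ, sq_nonneg e]
      refine hle.trans ?_
      have e4 : e ^ 4 = |e| ^ (4 : ℝ) := by
        rw [← Even.pow_abs (by decide : Even 4) e]
        exact_mod_cast (Real.rpow_natCast |e| 4).symm
      rw [e4, Real.rpow_add (ht.trans he'), mul_assoc]
      refine le_mul_of_one_le_right (by positivity) ?_
      rw [Real.rpow_neg ht.le, ← div_eq_mul_inv, one_le_div (by positivity)]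
      exact Real.rpow_le_rpow ht.le he'.le hη.le
    · rw [zero_pow two_ne_zero]; positivity

set_option maxHeartbeats 1000000 in
-- The deviation splits into the off-diagonal form, the truncated diagonal and the diagonal
-- remainder, each allowed a third of `δ n`. Truncating at `t = n^{1/8}` gives tails of order `n⁻²`,
-- `t⁴ n⁻²` and `t^{-η} n⁻¹`; any truncation exponent in `(0, 1/4)` would keep all of them summable.
-- `K` depends on neither `n` nor `A`, so the bound can be used conditionally on the inputs.
theorem quadForm_tail_bound (hη : 0 < η) (hν_mean : ∫ e, e ∂ν = 0)
    (hν_var : ∫ e, e ^ 2 ∂ν = σ ^ 2) (hν : Integrable (fun e : ℝ => |e| ^ (4 + η)) ν)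
    {C δ : ℝ} (hC : 0 ≤ C) (hδ : 0 < δ) :
    ∃ K : ℝ, 0 ≤ K ∧ ∀ n : ℕ, 1 ≤ n → |σ| ≤ (n : ℝ) ^ (1 / 8 : ℝ) →
      ∀ A : Matrix (Fin n) (Fin n) ℝ, ∑ i, ∑ j, A i j ^ 2 ≤ C * n →
      (Measure.pi fun _ : Fin n => ν).real
        {e | δ * n ≤ |e ⬝ᵥ (A *ᵥ e) - σ ^ 2 * A.trace|} ≤
        K * ((n : ℝ) ^ (-3 / 2 : ℝ) + (n : ℝ) ^ (-(1 + η / 8))) := by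
  have h4 := integrable_pow_four_of_moment hη hν
  set M4 := ∫ e, e ^ 4 ∂ν with hM4
  have hM4n : 0 ≤ M4 := integral_nonneg fun e => by positivity
  set V := ∫ e, (e ^ 2 - σ ^ 2) ^ 2 ∂ν with hV
  have hVn : 0 ≤ V := integral_nonneg fun e => by positivity
  set M := ∫ e, |e| ^ (4 + η) ∂ν with hM
  have hMn : 0 ≤ M := integral_nonneg fun e => by positivity
  set d := δ / 3 with hd
  have hdp : 0 < d := by positivity
  -- One constant per piece. The 8 in `K2` is the 4 of `fourth_moment_linear_form_le` times the 2 in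
  -- the fourth-moment bound of the truncated part.
  set K1 := (32 * M4 * C) ^ 2 / d ^ 4 with hK1
  set K2 := (8 * √V * C) ^ 2 / d ^ 4 with hK2
  set K3 := M * C / d ^ 2 with hK3
  have hK1n : 0 ≤ K1 := by positivity
  have hK2n : 0 ≤ K2 := by positivity
  have hK3n : 0 ≤ K3 := by positivity
  refine ⟨K1 + K2 + K3, by positivity, fun n hn hσn A hA => ?_⟩
  have hN1 : (1 : ℝ) ≤ n := by exact_mod_cast hn
  have hN : (0 : ℝ) < n := by linarith
  set N : ℝ := (n : ℝ) with hNdef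
  set t : ℝ := N ^ (1 / 8 : ℝ) with ht
  have htp : 0 < t := by positivity
  obtain ⟨g, h, hgm, hgh, hg0, hh0, hg4i, hh2, hg4, hh2le⟩ :=
    exists_truncation hη hν_var hν htp hσn
  set π := Measure.pi fun _ : Fin n => ν with hπ
  have hev : ∀ i : Fin n, MeasurePreserving (fun e : Fin n → ℝ => e i) π ν :=
    fun i => measurePreserving_eval (fun _ : Fin n => ν) i
  have tr : ∀ (i : Fin n) {f : ℝ → ℝ}, AEStronglyMeasurable f ν →
      ∫ e, f (e i) ∂π = ∫ s, f s ∂ν := fun i f hf => by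
    rw [← (hev i).map_eq] at hf
    rw [← (hev i).map_eq, integral_map (hev i).aemeasurable hf]
  have tri : ∀ (i : Fin n) {f : ℝ → ℝ}, Integrable f ν → Integrable (fun e => f (e i)) π :=
    fun i f hf => (hev i).integrable_comp_of_integrable hf
  have ind : iIndepFun (fun (i : Fin n) (e : Fin n → ℝ) => e i) π :=
    iIndepFun_pi (X := fun _ => id) fun _ => aemeasurable_id
  have indg : iIndepFun (fun (i : Fin n) (e : Fin n → ℝ) => g (e i)) π :=
    iIndepFun_pi (X := fun _ => g) fun _ => hgm.aemeasurable
  have indh : iIndepFun (fun (i : Fin n) (e : Fin n → ℝ) => h (e i)) π :=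
    iIndepFun_pi (X := fun _ => h) fun _ => hh2.aemeasurable
  let B : Fin n → Fin n → ℝ := fun i j => if i = j then 0 else A i j
  have hBA : ∑ i, ∑ j, B i j ^ 2 ≤ C * N := by
    refine le_trans (Finset.sum_le_sum fun i _ => Finset.sum_le_sum fun j _ => ?_) hA
    show (if i = j then 0 else A i j) ^ 2 ≤ A i j ^ 2
    split_ifs
    · rw [zero_pow two_ne_zero]; exact sq_nonneg _
    · exact le_rfl
  have hDA : ∑ i, A i i ^ 2 ≤ C * N :=
    le_trans (Finset.sum_le_sum fun i _ =>
      Finset.single_le_sum (f := fun j => A i j ^ 2) (fun j _ => sq_nonneg _) (Finset.mem_univ i)) hA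
  have Q := fourth_moment_offDiag_form_le (μ := π) (fun i => measurable_pi_apply i) ind
    (fun i => (tr i (f := fun s => s) (by fun_prop)).trans hν_mean)
    (fun i => tri i h4) (x := √M4) (Real.sqrt_nonneg _)
    (fun i => by rw [Real.sq_sqrt hM4n, tr i (f := fun s => s ^ 4) (by fun_prop)]) B
    (fun i => by simp [B]) Finset.univ
  have G := fourth_moment_linear_form_le (μ := π) (ξ := fun i e => g (e i))
    (fun i => hgm.comp (measurable_pi_apply i)) indg
    (fun i => (tr i hgm.aestronglyMeasurable).trans hg0)
    (fun i => tri i hg4i) (x := 2 * t ^ 2 * √V) (by positivity)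
    (fun i => by rw [tr i (f := fun s => g s ^ 4) hg4i.1]; exact hg4) (fun i => A i i) Finset.univ
  have H := second_moment_linear_form_le (μ := π) (ξ := fun i e => h (e i))
    (fun i => hh2.comp_measurePreserving (hev i)) indh
    (fun i => (tr i hh2.1).trans hh0) (v := M * t ^ (-η))
    (fun i => by rw [tr i (f := fun s => h s ^ 2) (hh2.1.pow 2)]; exact hh2le)
    (fun i => A i i) Finset.univ
  have hdecomp : ∀ e : Fin n → ℝ, e ⬝ᵥ (A *ᵥ e) - σ ^ 2 * A.trace =
      (∑ i, ∑ j, B i j * (e i * e j)) + ((∑ i, A i i * g (e i)) + ∑ i, A i i * h (e i)) := by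
    intro e
    have e1 : ∀ i, ∑ j, A i j * (e i * e j) = ∑ j, B i j * (e i * e j) + A i i * e i ^ 2 := by
      intro i
      have : A i i * e i ^ 2 = ∑ j, if i = j then A i j * (e i * e j) else 0 := by
        rw [Finset.sum_ite_eq, if_pos (Finset.mem_univ i)]; ring
      rw [this, ← Finset.sum_add_distrib]
      refine Finset.sum_congr rfl fun j _ => ?_
      by_cases hij : i = j <;> simp [B, hij]
    have e2 : e ⬝ᵥ (A *ᵥ e) = ∑ i, ∑ j, A i j * (e i * e j) := by
      simp only [dotProduct, mulVec, Finset.mul_sum]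
      exact Finset.sum_congr rfl fun i _ => Finset.sum_congr rfl fun j _ => by ring
    rw [e2]
    simp only [e1, Matrix.trace, Matrix.diag]
    rw [Finset.mul_sum, ← Finset.sum_sub_distrib, ← Finset.sum_add_distrib,
      ← Finset.sum_add_distrib]
    exact Finset.sum_congr rfl fun i _ => by linear_combination A i i * hgh (e i)
  have hsub : {e : Fin n → ℝ | δ * N ≤ |e ⬝ᵥ (A *ᵥ e) - σ ^ 2 * A.trace|} ⊆
      {e | d * N ≤ |∑ i, ∑ j, B i j * (e i * e j)|} ∪
        ({e | d * N ≤ |∑ i, A i i * g (e i)|} ∪ {e | d * N ≤ |∑ i, A i i * h (e i)|}) := by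
    intro e he
    simp only [Set.mem_union, Set.mem_ofPred_eq, hdecomp] at he ⊢
    by_contra! hcon
    have a1 := abs_add_le (∑ i, ∑ j, B i j * (e i * e j))
      ((∑ i, A i i * g (e i)) + ∑ i, A i i * h (e i))
    have a2 := abs_add_le (∑ i, A i i * g (e i)) (∑ i, A i i * h (e i))
    have : δ * N = d * N + d * N + d * N := by rw [hd]; ring
    linarith [hcon.1, hcon.2.1, hcon.2.2]
  have hdN : 0 < d * N := by positivity
  have t4 : t ^ 4 = N ^ (1 / 2 : ℝ) := by
    rw [ht, ← Real.rpow_natCast, ← Real.rpow_mul hN.le]; norm_num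
  have tη : t ^ (-η) = N ^ (-(η / 8)) := by
    rw [ht, ← Real.rpow_mul hN.le]; congr 1; ring
  have n32 : N ^ (-3 / 2 : ℝ) = t ^ 4 / N ^ 2 := by
    rw [t4, ← Real.rpow_natCast N 2, ← Real.rpow_sub hN]; norm_num
  have n1η : N ^ (-(1 + η / 8)) = t ^ (-η) / N := by
    rw [tη, neg_add, Real.rpow_add hN, Real.rpow_neg_one]; field_simp
  have ht1 : 1 ≤ t ^ 4 := by rw [t4]; exact Real.one_le_rpow hN1 (by norm_num)
  -- The natural rate `N⁻²` is weakened to the exponent of the second piece, using `1 ≤ t⁴`.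
  have b1 : π.real {e | d * N ≤ |∑ i, ∑ j, B i j * (e i * e j)|} ≤ K1 * N ^ (-3 / 2 : ℝ) := by
    refine (measureReal_abs_ge_le_of_pow_four hdN Q.1 (Q.2.trans
      (pow_le_pow_left₀ (by positivity) (mul_le_mul_of_nonneg_left hBA (by positivity)) 2))).trans ?_
    rw [n32, Real.sq_sqrt hM4n]
    calc (32 * M4 * (C * N)) ^ 2 / (d * N) ^ 4 = K1 * (1 / N ^ 2) := by
          rw [hK1]; field_simp
      _ ≤ _ := by gcongr
  have b2 : π.real {e | d * N ≤ |∑ i, A i i * g (e i)|} ≤ K2 * N ^ (-3 / 2 : ℝ) := by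
    refine (measureReal_abs_ge_le_of_pow_four hdN G.1 (G.2.trans
      (pow_le_pow_left₀ (by positivity) (mul_le_mul_of_nonneg_left hDA (by positivity)) 2))).trans ?_
    rw [n32]
    refine le_of_eq ?_
    rw [hK2]; field_simp; ring
  have b3 : π.real {e | d * N ≤ |∑ i, A i i * h (e i)|} ≤ K3 * N ^ (-(1 + η / 8)) := by
    refine (measureReal_abs_ge_le_of_sq hdN H.1 (H.2.trans
      (mul_le_mul_of_nonneg_left hDA (by positivity)))).trans ?_
    rw [n1η]
    refine le_of_eq ?_
    rw [hK3]; field_simp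
  have hp1 : 0 ≤ N ^ (-3 / 2 : ℝ) := by positivity
  have hp2 : 0 ≤ N ^ (-(1 + η / 8)) := by positivity
  calc _ ≤ _ := measureReal_mono hsub
    _ ≤ _ := measureReal_union_le _ _
    _ ≤ _ := add_le_add_right (measureReal_union_le _ _) _
    _ ≤ K1 * N ^ (-3 / 2 : ℝ) + (K2 * N ^ (-3 / 2 : ℝ) + K3 * N ^ (-(1 + η / 8))) := by gcongr
    _ ≤ _ := by nlinarith [mul_nonneg hK1n hp2, mul_nonneg hK2n hp2, mul_nonneg hK3n hp1]

end Concentration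

/-! ### The resolvent of a positive semidefinite matrix -/

section Resolvent

variable {n p : ℕ}

/-- The resolvent `(G + ρ)⁻¹`. -/
noncomputable def resolventMatrix (G : Matrix (Fin n) (Fin n) ℝ) (ρ : ℝ) :
    Matrix (Fin n) (Fin n) ℝ :=
  (G + ρ • 1)⁻¹

theorem resolventMatrix_pow_spectral {G : Matrix (Fin n) (Fin n) ℝ} (hG : G.IsHermitian)
    (hpos : ∀ i, 0 ≤ hG.eigenvalues i) {ρ : ℝ} (hρ : 0 < ρ) :
    IsUnit (G + ρ • 1).det ∧ ∀ k : ℕ, resolventMatrix G ρ ^ k =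
      (hG.eigenvectorUnitary : Matrix (Fin n) (Fin n) ℝ) *
        diagonal (fun i => (1 / (hG.eigenvalues i + ρ)) ^ k) *
        star (hG.eigenvectorUnitary : Matrix (Fin n) (Fin n) ℝ) := by
  set U : Matrix (Fin n) (Fin n) ℝ :=
    (hG.eigenvectorUnitary : Matrix (Fin n) (Fin n) ℝ) with hU
  have hUU : star U * U = 1 := Unitary.coe_star_mul_self hG.eigenvectorUnitary
  have hUU' : U * star U = 1 := Unitary.coe_mul_star_self hG.eigenvectorUnitary
  have hspec : G = U * diagonal hG.eigenvalues * star U := by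
    conv_lhs => rw [hG.spectral_theorem, Unitary.conjStarAlgAut_apply]
    rfl
  have hmul : ∀ a b : Fin n → ℝ, (U * diagonal a * star U) * (U * diagonal b * star U) =
      U * diagonal (fun i => a i * b i) * star U := by
    intro a b
    rw [← diagonal_mul_diagonal]
    calc _ = U * diagonal a * (star U * U) * diagonal b * star U := by simp only [mul_assoc]
      _ = _ := by rw [hUU]; simp only [mul_assoc, mul_one]
  have hone : U * diagonal (fun _ => (1 : ℝ)) * star U = 1 := by
    rw [diagonal_one, mul_one, hUU']
  have hGρ : G + ρ • 1 = U * diagonal (fun i => hG.eigenvalues i + ρ) * star U := by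
    rw [← diagonal_add, mul_add, add_mul, ← hspec]
    congr 1
    have : diagonal (fun _ : Fin n => ρ) = ρ • (1 : Matrix (Fin n) (Fin n) ℝ) := by
      rw [smul_one_eq_diagonal]
    rw [this, mul_smul_comm, mul_one, smul_mul_assoc, hUU']
  have hinv : (G + ρ • 1) * (U * diagonal (fun i => 1 / (hG.eigenvalues i + ρ)) * star U) = 1 := by
    rw [hGρ, hmul, ← hone]
    congr 3
    ext i
    have : hG.eigenvalues i + ρ ≠ 0 := by linarith [hpos i]
    field_simp
  refine ⟨isUnit_det_of_right_inverse hinv, fun k => ?_⟩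
  rw [resolventMatrix, inv_eq_right_inv hinv]
  induction k with
  | zero => simp only [pow_zero]; exact hone.symm
  | succ k ih => rw [pow_succ, ih, hmul]; simp only [← pow_succ]

theorem trace_resolventMatrix_pow {G : Matrix (Fin n) (Fin n) ℝ} (hG : G.IsHermitian)
    (hpos : ∀ i, 0 ≤ hG.eigenvalues i) {ρ : ℝ} (hρ : 0 < ρ) (k : ℕ) :
    (resolventMatrix G ρ ^ k).trace = ∑ i, (1 / (hG.eigenvalues i + ρ)) ^ k := by
  rw [(resolventMatrix_pow_spectral hG hpos hρ).2 k, trace_mul_cycle,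
    Unitary.coe_star_mul_self hG.eigenvectorUnitary, one_mul, trace_diagonal]

theorem resolventMatrix_transpose {G : Matrix (Fin n) (Fin n) ℝ} (hG : G.IsHermitian) (ρ : ℝ) :
    (resolventMatrix G ρ)ᵀ = resolventMatrix G ρ := by
  have h : Gᵀ = G := by simpa [Matrix.IsHermitian, conjTranspose_eq_transpose_of_trivial] using hG
  rw [resolventMatrix, transpose_nonsing_inv, transpose_add, h, transpose_smul, transpose_one]

theorem mul_resolventMatrix {G : Matrix (Fin n) (Fin n) ℝ} (hG : G.IsHermitian)
    (hpos : ∀ i, 0 ≤ hG.eigenvalues i) {ρ : ℝ} (hρ : 0 < ρ) :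
    G * resolventMatrix G ρ = 1 - ρ • resolventMatrix G ρ := by
  have h := mul_nonsing_inv _ (resolventMatrix_pow_spectral hG hpos hρ).1
  rw [add_mul, smul_mul_assoc, one_mul] at h
  exact eq_sub_of_add_eq h

/-- By symmetry the squared Frobenius norm of `Aᵏ` is `tr A²ᵏ`, and every eigenvalue of `A` is at
most `1/ρ`. This is the hypothesis on the matrix in `quadForm_tail_bound`. -/
theorem sum_sq_entries_resolventMatrix_pow_le {G : Matrix (Fin n) (Fin n) ℝ} (hG : G.IsHermitian)
    (hpos : ∀ i, 0 ≤ hG.eigenvalues i) {ρ : ℝ} (hρ : 0 < ρ) (k : ℕ) :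
    ∑ i, ∑ j, (resolventMatrix G ρ ^ k) i j ^ 2 ≤ (1 / ρ) ^ (2 * k) * n := by
  have ht : (resolventMatrix G ρ ^ k)ᵀ = resolventMatrix G ρ ^ k := by
    rw [transpose_pow, resolventMatrix_transpose hG]
  have e : ∑ i, ∑ j, (resolventMatrix G ρ ^ k) i j ^ 2 = (resolventMatrix G ρ ^ (2 * k)).trace := by
    rw [two_mul, pow_add]
    simp only [trace, diag, mul_apply]
    refine Finset.sum_congr rfl fun i _ => Finset.sum_congr rfl fun j _ => ?_
    rw [sq]
    congr 1
    conv_rhs => rw [← ht]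
    rfl
  rw [e, trace_resolventMatrix_pow hG hpos hρ]
  calc _ ≤ ∑ _i : Fin n, (1 / ρ) ^ (2 * k) := by
        refine Finset.sum_le_sum fun i _ => ?_
        have := hpos i
        gcongr
        linarith
    _ = _ := by simp [mul_comm]

end Resolvent

/-! ### Ridge regression on pure noise and its optimality -/

section Ridge

variable {n p : ℕ}

/-- Ridge estimator for the noise: the minimiser of `‖e - W θ‖² + ρ p ‖θ‖²`. -/
noncomputable def ridge (W : Matrix (Fin n) (Fin p) ℝ) (ρ : ℝ) (e : Fin n → ℝ) : Fin p → ℝ :=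
  (1 / (p : ℝ)) • (Wᵀ *ᵥ (resolventMatrix ((1 / (p : ℝ)) • (W * Wᵀ)) ρ *ᵥ e))

variable {W : Matrix (Fin n) (Fin p) ℝ} {ρ : ℝ}

theorem mulVec_ridge (hG : ((1 / (p : ℝ)) • (W * Wᵀ)).IsHermitian)
    (hpos : ∀ i, 0 ≤ hG.eigenvalues i) (hρ : 0 < ρ) (e : Fin n → ℝ) :
    W *ᵥ ridge W ρ e =
      e - ρ • (resolventMatrix ((1 / (p : ℝ)) • (W * Wᵀ)) ρ *ᵥ e) := by
  have h := congrArg (fun M : Matrix (Fin n) (Fin n) ℝ => M *ᵥ e) (mul_resolventMatrix hG hpos hρ)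
  simp only [sub_mulVec, one_mulVec, smul_mulVec] at h
  rw [← h, ridge, mulVec_smul, mulVec_mulVec, mulVec_mulVec, ← smul_mulVec, smul_mul_assoc]

theorem ridge_residual_sq (hG : ((1 / (p : ℝ)) • (W * Wᵀ)).IsHermitian)
    (hpos : ∀ i, 0 ≤ hG.eigenvalues i) (hρ : 0 < ρ) (e : Fin n → ℝ) :
    (e - W *ᵥ ridge W ρ e) ⬝ᵥ (e - W *ᵥ ridge W ρ e) =
      ρ ^ 2 * (e ⬝ᵥ ((resolventMatrix ((1 / (p : ℝ)) • (W * Wᵀ)) ρ ^ 2) *ᵥ e)) := by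
  set A := resolventMatrix ((1 / (p : ℝ)) • (W * Wᵀ)) ρ with hA
  have ht : Aᵀ = A := resolventMatrix_transpose hG ρ
  rw [mulVec_ridge hG hpos hρ, sub_sub_cancel, smul_dotProduct, dotProduct_smul, smul_eq_mul,
    smul_eq_mul, sq A, ← mulVec_mulVec, dotProduct_mulVec e A, ← mulVec_transpose, ht]
  ring

/-- Pairing `θ = Wᵀ A e / p` with itself moves `Wᵀ` across the product, and `Wθ = e - ρ A e` then
eliminates `W`. -/
theorem ridge_sq (hG : ((1 / (p : ℝ)) • (W * Wᵀ)).IsHermitian)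
    (hpos : ∀ i, 0 ≤ hG.eigenvalues i) (hρ : 0 < ρ) (e : Fin n → ℝ) :
    ridge W ρ e ⬝ᵥ ridge W ρ e =
      (1 / (p : ℝ)) * (e ⬝ᵥ (resolventMatrix ((1 / (p : ℝ)) • (W * Wᵀ)) ρ *ᵥ e) -
        ρ * (e ⬝ᵥ ((resolventMatrix ((1 / (p : ℝ)) • (W * Wᵀ)) ρ ^ 2) *ᵥ e))) := by
  have h1 := mulVec_ridge hG hpos hρ e
  set A := resolventMatrix ((1 / (p : ℝ)) • (W * Wᵀ)) ρ with hA
  have ht : Aᵀ = A := resolventMatrix_transpose hG ρ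
  conv_lhs => enter [1]; rw [ridge]
  rw [← hA, smul_dotProduct, mulVec_transpose, ← dotProduct_mulVec, h1, dotProduct_sub,
    dotProduct_smul, sq A, ← mulVec_mulVec, dotProduct_mulVec e A (A *ᵥ e), ← mulVec_transpose, ht,
    dotProduct_comm (A *ᵥ e) e]
  simp only [smul_eq_mul]

/-- For `θ = t + d`, fitting no worse than the ridge solution `t` forces `2ρp t·d ≥ ‖Wd‖² ≥ 0`, so
`‖t + d‖² ≥ ‖t‖² + ‖d‖²`. -/
theorem ridge_optimal (hG : ((1 / (p : ℝ)) • (W * Wᵀ)).IsHermitian)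
    (hpos : ∀ i, 0 ≤ hG.eigenvalues i) (hρ : 0 < ρ) (hp : 0 < p) (e : Fin n → ℝ) (θ : Fin p → ℝ)
    (h : (e - W *ᵥ θ) ⬝ᵥ (e - W *ᵥ θ) ≤ (e - W *ᵥ ridge W ρ e) ⬝ᵥ (e - W *ᵥ ridge W ρ e)) :
    ridge W ρ e ⬝ᵥ ridge W ρ e ≤ θ ⬝ᵥ θ := by
  have h1 := mulVec_ridge hG hpos hρ e
  set A := resolventMatrix ((1 / (p : ℝ)) • (W * Wᵀ)) ρ with hA
  set t := ridge W ρ e with htdef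
  have hp' : (0 : ℝ) < p := by exact_mod_cast hp
  obtain ⟨d, rfl⟩ : ∃ d, θ = t + d := ⟨θ - t, by simp⟩
  have hr : e - W *ᵥ t = ρ • (A *ᵥ e) := by rw [h1, sub_sub_cancel]
  -- The normal equation `Wᵀ(e - W t) = ρ p t`, tested against `d`.
  have hort : (e - W *ᵥ t) ⬝ᵥ (W *ᵥ d) = ρ * p * (t ⬝ᵥ d) := by
    rw [hr, dotProduct_mulVec, ← mulVec_transpose, mulVec_smul, smul_dotProduct, htdef, ridge,
      ← hA, smul_dotProduct]
    simp only [smul_eq_mul]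
    field_simp
  have e1 : e - W *ᵥ (t + d) = (e - W *ᵥ t) - W *ᵥ d := by rw [mulVec_add]; abel
  rw [e1] at h
  generalize e - W *ᵥ t = r at h hort
  rw [sub_dotProduct, dotProduct_sub, dotProduct_sub, dotProduct_comm (W *ᵥ d) r, hort] at h
  have hnn : 0 ≤ (W *ᵥ d) ⬝ᵥ (W *ᵥ d) := Finset.sum_nonneg fun i _ => mul_self_nonneg _
  have hdd : 0 ≤ d ⬝ᵥ d := Finset.sum_nonneg fun i _ => mul_self_nonneg _
  have htd : 0 ≤ t ⬝ᵥ d := by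
    have : 0 ≤ ρ * p * (t ⬝ᵥ d) := by linarith
    exact nonneg_of_mul_nonneg_right this (by positivity)
  rw [add_dotProduct, dotProduct_add, dotProduct_add, dotProduct_comm d t]
  linarith

end Ridge

/-! ### Stieltjes transforms and the limiting ridge training loss -/

section StieltjesTransform

variable {m : Measure ℝ}

theorem hasDerivAt_stieltjes [IsFiniteMeasure m] (hm : ∀ᵐ s ∂m, 0 ≤ s) {l : ℝ} (hl : 0 < l) :
    HasDerivAt (fun z => ∫ s, 1 / (s - z) ∂m) (∫ s, (1 / (s + l)) ^ 2 ∂m) (-l) := by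
  -- On this ball `s - z > l/2` for `s ≥ 0`, so a constant dominates the derivative of the
  -- integrand.
  have hmem : Metric.ball (-l) (l / 2) ∈ 𝓝 (-l) := Metric.ball_mem_nhds _ (by positivity)
  have hz : ∀ z ∈ Metric.ball (-l) (l / 2), z < -(l / 2) := fun z hz => by
    rw [Metric.mem_ball, Real.dist_eq, abs_lt] at hz
    linarith [hz.2]
  have h := hasDerivAt_integral_of_dominated_loc_of_deriv_le (μ := m) (𝕜 := ℝ)
    (F := fun z s => 1 / (s - z)) (F' := fun z s => (1 / (s - z)) ^ 2) (x₀ := -l)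
    (bound := fun _ => (1 / (l / 2)) ^ 2) hmem
    (Eventually.of_forall fun z => by
      exact Measurable.aestronglyMeasurable (by fun_prop)) ?_
    (Measurable.aestronglyMeasurable (by fun_prop)) ?_ (integrable_const _) ?_
  · simpa only [sub_neg_eq_add] using h.2
  · refine Integrable.of_bound (C := 1 / l) (Measurable.aestronglyMeasurable (by fun_prop)) ?_
    filter_upwards [hm] with s hs
    rw [Real.norm_of_nonneg (by rw [sub_neg_eq_add]; positivity)]
    exact one_div_le_one_div_of_le hl (by linarith)
  · filter_upwards [hm] with s hs z hzb
    have := hz z hzb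
    rw [Real.norm_of_nonneg (by positivity)]
    have h1 : 0 < s - z := by linarith
    exact pow_le_pow_left₀ (by positivity)
      (one_div_le_one_div_of_le (by positivity) (by linarith)) 2
  · filter_upwards [hm] with s hs z hzb
    have := hz z hzb
    have h1 : s - z ≠ 0 := by linarith
    have := ((hasDerivAt_id z).const_sub s).inv h1
    simp only [id_eq, neg_neg] at this
    rw [_root_.one_div_pow]
    refine this.congr_of_eventuallyEq (Eventually.of_forall fun x => ?_)
    simp

/-- Limiting training loss (in units of the noise variance) of ridge regression. -/
noncomputable def ridgeLoss (m : Measure ℝ) (l : ℝ) : ℝ := ∫ s, (l / (s + l)) ^ 2 ∂m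

theorem ridgeLoss_eq (m : Measure ℝ) (l : ℝ) :
    ridgeLoss m l = l ^ 2 * ∫ s, (1 / (s + l)) ^ 2 ∂m := by
  rw [ridgeLoss, ← integral_const_mul]
  congr 1
  ext s
  rw [← mul_pow, mul_one_div]

theorem ratio_mem_Icc {l s : ℝ} (hl : 0 < l) (hs : 0 ≤ s) :
    0 ≤ l / (s + l) ∧ l / (s + l) ≤ 1 :=
  ⟨by positivity, by rw [div_le_one (by positivity)]; linarith⟩

theorem integrable_ridgeLoss [IsFiniteMeasure m] (hm : ∀ᵐ s ∂m, 0 ≤ s) {l : ℝ} (hl : 0 < l) :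
    Integrable (fun s => (l / (s + l)) ^ 2) m := by
  refine Integrable.of_bound (C := 1) (Measurable.aestronglyMeasurable (by fun_prop)) ?_
  filter_upwards [hm] with s hs
  rw [Real.norm_of_nonneg (by positivity)]
  exact pow_le_one₀ (ratio_mem_Icc hl hs).1 (ratio_mem_Icc hl hs).2

/-- Dominated convergence with an integrand in `[0, 1]`. The filter is general because the limits at
`l > 0`, at infinity and at `0⁺` are all needed. -/
theorem tendsto_ridgeLoss [IsFiniteMeasure m] (hm : ∀ᵐ s ∂m, 0 ≤ s) {F : Filter ℝ}
    [F.IsCountablyGenerated] (hF : ∀ᶠ l in F, 0 < l) {f : ℝ → ℝ}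
    (hf : ∀ s, 0 ≤ s → Tendsto (fun l => (l / (s + l)) ^ 2) F (𝓝 (f s))) :
    Tendsto (ridgeLoss m) F (𝓝 (∫ s, f s ∂m)) := by
  refine tendsto_integral_filter_of_dominated_convergence (fun _ => (1 : ℝ))
    (Eventually.of_forall fun l => Measurable.aestronglyMeasurable (by fun_prop)) ?_
    (integrable_const _) (hm.mono hf)
  filter_upwards [hF] with l hl
  filter_upwards [hm] with s hs
  rw [Real.norm_of_nonneg (by positivity)]
  exact pow_le_one₀ (ratio_mem_Icc hl hs).1 (ratio_mem_Icc hl hs).2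

theorem continuousAt_ridgeLoss [IsFiniteMeasure m] (hm : ∀ᵐ s ∂m, 0 ≤ s) {l : ℝ} (hl : 0 < l) :
    ContinuousAt (ridgeLoss m) l := by
  refine tendsto_ridgeLoss hm (lt_mem_nhds hl) fun s hs => ?_
  have : s + l ≠ 0 := by positivity
  exact ContinuousAt.tendsto (f := fun l => (l / (s + l)) ^ 2) (by fun_prop (disch := assumption))

theorem tendsto_ridgeLoss_atTop [IsProbabilityMeasure m] (hm : ∀ᵐ s ∂m, 0 ≤ s) :
    Tendsto (ridgeLoss m) atTop (𝓝 1) := by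
  have := tendsto_ridgeLoss hm (eventually_gt_atTop 0) (f := fun _ => 1) fun s hs => ?_
  · simpa using this
  · have h1 : Tendsto (fun l : ℝ => s / (s + l)) atTop (𝓝 0) :=
      Tendsto.const_div_atTop (tendsto_atTop_add_const_left _ _ tendsto_id) s
    have h2 : Tendsto (fun l : ℝ => (1 - s / (s + l)) ^ 2) atTop (𝓝 1) := by
      simpa using (h1.const_sub 1).pow 2
    refine h2.congr' ?_
    filter_upwards [eventually_gt_atTop 0] with l hl
    have : s + l ≠ 0 := by positivity
    field_simp
    ring

/-- As `l → 0⁺` the integrand tends to the indicator of `{0}`, so only the atom survives; it is the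
lower end of the range of admissible `τ`. -/
theorem tendsto_ridgeLoss_zero [IsFiniteMeasure m] (hm : ∀ᵐ s ∂m, 0 ≤ s) :
    Tendsto (ridgeLoss m) (𝓝[>] 0) (𝓝 (m.real {0})) := by
  have := tendsto_ridgeLoss hm (F := 𝓝[>] 0) (eventually_mem_nhdsWithin)
    (f := ({0} : Set ℝ).indicator 1) fun s hs => ?_
  · rwa [integral_indicator_one (measurableSet_singleton 0)] at this
  · rcases hs.eq_or_lt with rfl | hs
    · simp only [Set.mem_singleton_iff, Set.indicator_of_mem, Pi.one_apply]
      refine tendsto_const_nhds.congr' ?_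
      filter_upwards [eventually_mem_nhdsWithin] with l hl
      have : l ≠ 0 := ne_of_gt hl
      simp [this]
    · rw [Set.indicator_of_notMem (by simpa using hs.ne')]
      have hc : ContinuousAt (fun l : ℝ => (l / (s + l)) ^ 2) 0 := by
        have : s + 0 ≠ 0 := by linarith
        fun_prop (disch := assumption)
      have := hc.tendsto.mono_left (nhdsWithin_le_nhds (s := Set.Ioi 0))
      simpa using this

/-- The integrand increases strictly in `l` at every `s > 0`, so equal integrals would force all the
mass onto `{0}`. -/
theorem ridgeLoss_strictMonoOn [IsProbabilityMeasure m] (hm : ∀ᵐ s ∂m, 0 ≤ s)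
    (hm0 : m.real {0} < 1) : StrictMonoOn (ridgeLoss m) (Set.Ioi 0) := by
  intro l hl l' hl' hll
  have hl : 0 < l := hl
  have hl' : 0 < l' := hl'
  have hle : ∀ᵐ s ∂m, 0 ≤ (l' / (s + l')) ^ 2 - (l / (s + l)) ^ 2 := by
    filter_upwards [hm] with s hs
    refine sub_nonneg.2 (pow_le_pow_left₀ (ratio_mem_Icc hl hs).1 ?_ 2)
    rw [div_le_div_iff₀ (by positivity) (by positivity)]
    nlinarith
  have hi := (integrable_ridgeLoss hm hl').sub (integrable_ridgeLoss hm hl)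
  have hsub := integral_sub (integrable_ridgeLoss hm hl') (integrable_ridgeLoss hm hl)
  suffices 0 < ∫ s, ((l' / (s + l')) ^ 2 - (l / (s + l)) ^ 2) ∂m by
    rw [hsub] at this
    exact sub_pos.1 this
  rw [integral_pos_iff_support_of_nonneg_ae hle hi, pos_iff_ne_zero]
  · intro h0
    have hpos : ∀ s : ℝ, 0 < s → (l / (s + l)) ^ 2 < (l' / (s + l')) ^ 2 := fun s hs => by
      refine pow_lt_pow_left₀ ?_ (ratio_mem_Icc hl hs.le).1 two_ne_zero
      rw [div_lt_div_iff₀ (by positivity) (by positivity)]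
      nlinarith
    have h1 : m {(0 : ℝ)}ᶜ = 0 := by
      have hneg : m {s : ℝ | ¬ 0 ≤ s} = 0 := hm
      refine measure_mono_null (fun s hs => ?_) (measure_union_null hneg h0)
      rcases lt_trichotomy s 0 with h | h | h
      · exact Or.inl (not_le.2 h)
      · exact absurd h hs
      · exact Or.inr (sub_pos.2 (hpos s h)).ne'
    have h2 := (prob_compl_eq_zero_iff (measurableSet_singleton (0 : ℝ))).1 h1
    rw [measureReal_def, h2] at hm0
    simp at hm0

theorem exists_ridgeLoss_eq [IsProbabilityMeasure m] (hm : ∀ᵐ s ∂m, 0 ≤ s) {τ : ℝ}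
    (h0 : m.real {0} < τ) (h1 : τ < 1) : ∃ l, 0 < l ∧ ridgeLoss m l = τ := by
  obtain ⟨a, ha, ha0⟩ := (((tendsto_ridgeLoss_zero hm).eventually (gt_mem_nhds h0)).and
    eventually_mem_nhdsWithin).exists
  have ha0 : 0 < a := ha0
  obtain ⟨b, hb, hab⟩ := (((tendsto_ridgeLoss_atTop hm).eventually (lt_mem_nhds h1)).and
    (eventually_ge_atTop a)).exists
  obtain ⟨l, hl, hlτ⟩ := intermediate_value_Icc hab
    (fun x hx => (continuousAt_ridgeLoss hm (ha0.trans_le hx.1)).continuousWithinAt)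
    ⟨ha.le, hb.le⟩
  exact ⟨l, ha0.trans_le hl.1, hlτ⟩

end StieltjesTransform

/-! ### The Marchenko-Pastur law and convergence of resolvent traces -/

section MarchenkoPastur

theorem marchenkoPastur_ae_nonneg (γ : ℝ) : ∀ᵐ s ∂(marchenkoPastur γ), 0 ≤ s := by
  rw [marchenkoPastur, ae_add_measure_iff]
  constructor
  · refine Measure.ae_smul_measure ?_ _
    rw [ae_dirac_iff measurableSet_Ici]
  · refine (withDensity_absolutelyContinuous _ _).ae_le ?_
    filter_upwards [ae_restrict_mem measurableSet_Icc] with s hs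
    exact (sq_nonneg _).trans hs.1

theorem marchenkoPastur_real_zero (γ : ℝ) :
    (marchenkoPastur γ).real {0} = max 0 (1 - 1 / γ) := by
  have h : ((volume.restrict (Set.Icc ((1 - √γ) ^ 2) ((1 + √γ) ^ 2))).withDensity
      (fun x => ENNReal.ofReal
        (1 / (γ * (2 * Real.pi) * x) * √(((1 + √γ) ^ 2 - x) * (x - (1 - √γ) ^ 2))))) {(0 : ℝ)} = 0 :=
    withDensity_absolutelyContinuous _ _ (by simp)
  rw [measureReal_def, marchenkoPastur, Measure.add_apply, h, add_zero, Measure.smul_apply]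
  simp [ENNReal.toReal_ofReal', max_comm]

theorem hasDerivAt_mpStieltjes {γ : ℝ} [IsFiniteMeasure (marchenkoPastur γ)] {l : ℝ} (hl : 0 < l) :
    HasDerivAt (mpStieltjes γ) (∫ s, (1 / (s + l)) ^ 2 ∂(marchenkoPastur γ)) (-l) :=
  hasDerivAt_stieltjes (marchenkoPastur_ae_nonneg γ) hl

theorem sq_mul_deriv_mpStieltjes {γ : ℝ} [IsFiniteMeasure (marchenkoPastur γ)] {l : ℝ}
    (hl : 0 < l) : l ^ 2 * deriv (mpStieltjes γ) (-l) = ridgeLoss (marchenkoPastur γ) l := by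
  rw [(hasDerivAt_mpStieltjes hl).deriv, ridgeLoss_eq]

/-- Near `l` the term with the derivative equals `ridgeLoss / l`, whose continuity is already known;
no second derivative of the transform is needed. -/
theorem continuousAt_mpStieltjes_excess {γ : ℝ} [IsFiniteMeasure (marchenkoPastur γ)] {l : ℝ}
    (hl : 0 < l) :
    ContinuousAt (fun l => mpStieltjes γ (-l) - l * deriv (mpStieltjes γ) (-l)) l := by
  have h1 : ContinuousAt (fun l => mpStieltjes γ (-l)) l :=
    ContinuousAt.comp (f := fun l : ℝ => -l) (hasDerivAt_mpStieltjes hl).continuousAt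
      continuous_neg.continuousAt
  have h2 : ContinuousAt (fun l => ridgeLoss (marchenkoPastur γ) l / l) l :=
    (continuousAt_ridgeLoss (marchenkoPastur_ae_nonneg γ) hl).div continuousAt_id hl.ne'
  refine (h1.sub h2).congr ?_
  filter_upwards [lt_mem_nhds hl] with x hx
  show mpStieltjes γ (-x) - ridgeLoss (marchenkoPastur γ) x / x = _
  rw [← sq_mul_deriv_mpStieltjes hx]
  field_simp

variable {n : ℕ → ℕ} {A : (k : ℕ) → Matrix (Fin (n k)) (Fin (n k)) ℝ}

theorem integral_esd {N : ℕ} {A : Matrix (Fin N) (Fin N) ℝ} (hA : A.IsHermitian) (f : ℝ → ℝ) :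
    ∫ s, f s ∂(esd hA) = (N : ℝ)⁻¹ * ∑ i, f (hA.eigenvalues i) := by
  rw [esd, integral_smul_measure, integral_finsetSum_measure fun i _ => by
    exact integrable_dirac (by simp)]
  simp

/-- Testing against the constant 1 fixes the total mass, so the Marchenko-Pastur density never has
to be integrated. Infinite mass is excluded too, since its real value would be 0 rather than 1. -/
theorem isProbabilityMeasure_of_weaklyConverges_esd (hn : Tendsto n atTop atTop)
    (hA : ∀ k, (A k).IsHermitian) {m : Measure ℝ} (h : WeaklyConverges (fun k => esd (hA k)) m) :
    IsProbabilityMeasure m := by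
  have h1 := h 1
  have h2 : Tendsto (fun k => ∫ s, (1 : ℝ →ᵇ ℝ) s ∂(esd (hA k))) atTop (𝓝 1) := by
    refine tendsto_const_nhds.congr' ?_
    filter_upwards [hn.eventually_gt_atTop 0] with k hk
    have : (n k : ℝ) ≠ 0 := by exact_mod_cast hk.ne'
    rw [integral_esd]
    simp [this]
  have h3 := tendsto_nhds_unique h1 h2
  simp only [BoundedContinuousFunction.coe_one, Pi.one_apply, integral_const, smul_eq_mul,
    mul_one, measureReal_def] at h3
  exact ⟨by rw [← ENNReal.toReal_eq_one_iff]; exact h3⟩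

/-- The bounded continuous function equal to `(1 / (s + l)) ^ j` on `[0, ∞)`. -/
noncomputable def resolventBCF (l : ℝ) (hl : 0 < l) (j : ℕ) : ℝ →ᵇ ℝ :=
  BoundedContinuousFunction.ofNormedAddCommGroup (fun s => (1 / (max s 0 + l)) ^ j)
    (by
      refine Continuous.pow (Continuous.div continuous_const (by fun_prop) fun s => ?_) j
      have := le_max_right s 0
      positivity) ((1 / l) ^ j)
    (fun s => by
      have := le_max_right s 0
      rw [Real.norm_of_nonneg (by positivity)]
      exact pow_le_pow_left₀ (by positivity) (one_div_le_one_div_of_le hl (by linarith)) j)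

/-- The normalised trace is an integral against the empirical spectral distribution. Clamping `s` at
0 gives a bounded test function on all of `ℝ` and changes nothing, as the eigenvalues and the limit
law live on `[0, ∞)`. -/
theorem tendsto_trace_resolventMatrix_pow (hA : ∀ k, (A k).IsHermitian)
    (hpos : ∀ k i, 0 ≤ (hA k).eigenvalues i) {m : Measure ℝ} (hm : ∀ᵐ s ∂m, 0 ≤ s)
    (h : WeaklyConverges (fun k => esd (hA k)) m) {l : ℝ} (hl : 0 < l) (j : ℕ) :
    Tendsto (fun k => (n k : ℝ)⁻¹ * (resolventMatrix (A k) l ^ j).trace) atTop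
      (𝓝 (∫ s, (1 / (s + l)) ^ j ∂m)) := by
  have h1 := h (resolventBCF l hl j)
  have e : ∫ s, resolventBCF l hl j s ∂m = ∫ s, (1 / (s + l)) ^ j ∂m := by
    refine integral_congr_ae ?_
    filter_upwards [hm] with s hs
    show (1 / (max s 0 + l)) ^ j = _
    rw [max_eq_left hs]
  rw [e] at h1
  refine h1.congr fun k => ?_
  rw [integral_esd, trace_resolventMatrix_pow (hA k) (hpos k) hl]
  congr 1
  refine Finset.sum_congr rfl fun i _ => ?_
  show (1 / (max _ 0 + l)) ^ j = _
  rw [max_eq_left (hpos k i)]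

end MarchenkoPastur

/-! ### Training loss in terms of the noise vector -/

section TrainLoss

variable {X : Type*} {n p : ℕ}

/-- The noise vector of a data set under the linear model with coefficient vector `b`. -/
noncomputable def noise (φ : X → Fin p → ℝ) (b : Fin p → ℝ) (D : Fin n → X × ℝ) : Fin n → ℝ :=
  fun i => (D i).2 - linPred φ b (D i).1

theorem trainLoss_linPred (φ : X → Fin p → ℝ) (D : Fin n → X × ℝ) (b b' : Fin p → ℝ) :
    trainLoss D (linPred φ b') = (1 / (n : ℝ)) *
      ((noise φ b D - featureMatrix φ D *ᵥ (b' - b)) ⬝ᵥ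
        (noise φ b D - featureMatrix φ D *ᵥ (b' - b))) := by
  rw [trainLoss, dotProduct]
  congr 1
  refine Finset.sum_congr rfl fun i _ => ?_
  have e : (noise φ b D - featureMatrix φ D *ᵥ (b' - b)) i = (D i).2 - linPred φ b' (D i).1 := by
    simp only [noise, linPred, Pi.sub_apply, mulVec_sub, mulVec, featureMatrix, of_apply]
    simp only [dotProduct_comm _ (φ (D i).1)]
    have : (fun j => φ (D i).1 j) = φ (D i).1 := rfl
    show _ - φ (D i).1 ⬝ᵥ b - (φ (D i).1 ⬝ᵥ b' - φ (D i).1 ⬝ᵥ b) = _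
    ring
  rw [e, sq]

end TrainLoss

/-! ### Regression function and excess loss in the linear model -/

section LinearModel

variable {X : Type*} [MeasurableSpace X] {n p : ℕ}

/-- `P` is the law of `(x, bᵀ φ(x) + ε)` with `ε ~ ν` independent of `x`. -/
def IsLinearModelWith (P : Measure (X × ℝ)) (φ : X → Fin p → ℝ) (ν : Measure ℝ)
    (b : Fin p → ℝ) : Prop :=
  P = (P.fst.prod ν).map (fun z => (z.1, linPred φ b z.1 + z.2))

variable {P : Measure (X × ℝ)} [IsProbabilityMeasure P] {φ : X → Fin p → ℝ} {ν : Measure ℝ}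
  [IsProbabilityMeasure ν] {b : Fin p → ℝ} {σ τ : ℝ}

theorem measurable_linPred (hφ : Measurable φ) (b : Fin p → ℝ) : Measurable (linPred φ b) := by
  unfold linPred dotProduct
  fun_prop

theorem measurable_shear (hφ : Measurable φ) (b : Fin p → ℝ) :
    Measurable fun z : X × ℝ => (z.1, linPred φ b z.1 + z.2) := by
  have := measurable_linPred hφ b
  fun_prop

/-- The kernel sending `x` to the law of `bᵀφ(x) + ε` disintegrates `P`, so it agrees almost
everywhere with the conditional kernel; its mean is `bᵀφ(x)` because the noise is centred. -/
theorem regressionFunction_ae_eq (hφ : Measurable φ) (hP : IsLinearModelWith P φ ν b)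
    (hν0 : ∫ e, e ∂ν = 0) (hν1 : Integrable (fun e : ℝ => e) ν) :
    ∀ᵐ x ∂P.fst, regressionFunction P x = linPred φ b x := by
  have hb := measurable_linPred hφ b
  let κ : Kernel X ℝ := (Kernel.id ×ₖ Kernel.const X ν).map fun z => linPred φ b z.1 + z.2
  have hm : Measurable fun z : X × ℝ => linPred φ b z.1 + z.2 := by fun_prop
  have hκ : ∀ x, κ x = ν.map fun e => linPred φ b x + e := fun x => by
    rw [Kernel.map_apply _ hm, Kernel.prod_apply, Kernel.id_apply, Kernel.const_apply,
      Measure.dirac_prod, Measure.map_map hm (by fun_prop)]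
    rfl
  have : IsMarkovKernel κ := Kernel.IsMarkovKernel.map _ hm
  have hcomp : P = P.fst ⊗ₘ κ := by
    refine Measure.ext fun s hs => ?_
    conv_lhs => rw [hP]
    rw [Measure.map_apply (measurable_shear hφ b) hs,
      Measure.prod_apply (measurable_shear hφ b hs), Measure.compProd_apply hs]
    refine lintegral_congr fun x => ?_
    rw [hκ, Measure.map_apply (by fun_prop) (measurable_prodMk_left hs)]
    rfl
  filter_upwards [eq_condKernel_of_measure_eq_compProd κ hcomp] with x hx
  rw [regressionFunction, ← hx, hκ, integral_map (by fun_prop) (by fun_prop),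
    integral_add (integrable_const _) hν1, hν0]
  simp

theorem integrable_feature_mul {Q : Measure X} (h : ∀ j, MemLp (fun x => φ x j) 2 Q) (i j : Fin p) :
    Integrable (fun x => φ x i * φ x j) Q := (h i).integrable_mul (h j)

theorem integral_linPred_sq {Q : Measure X} (h : ∀ j, MemLp (fun x => φ x j) 2 Q) (v : Fin p → ℝ) :
    ∫ x, linPred φ v x ^ 2 ∂Q = v ⬝ᵥ (featureCov Q φ *ᵥ v) := by
  have e : ∀ x, linPred φ v x ^ 2 = ∑ i, ∑ j, v i * v j * (φ x i * φ x j) := fun x => by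
    rw [sq, linPred, dotProduct, Finset.sum_mul_sum]
    exact Finset.sum_congr rfl fun i _ => Finset.sum_congr rfl fun j _ => by ring
  simp only [e]
  rw [integral_finsetSum _ fun i _ => integrable_finsetSum _ fun j _ =>
    (integrable_feature_mul h i j).const_mul _]
  simp only [dotProduct, mulVec, Finset.mul_sum]
  refine Finset.sum_congr rfl fun i _ => ?_
  rw [integral_finsetSum _ fun j _ => (integrable_feature_mul h i j).const_mul _]
  refine Finset.sum_congr rfl fun j _ => ?_
  rw [integral_const_mul, featureCov, Matrix.of_apply]
  ring

theorem memLp_linPred {Q : Measure X} (h : ∀ j, MemLp (fun x => φ x j) 2 Q) (v : Fin p → ℝ) :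
    MemLp (linPred φ v) 2 Q := by
  show MemLp (fun x => ∑ i, v i * φ x i) 2 Q
  exact memLp_finsetSum Finset.univ fun i _ => (h i).const_mul (v i)

/-- The risk of a predictor that differs from the regression function by `g`. -/
theorem risk_eq (hφ : Measurable φ) (hP : IsLinearModelWith P φ ν b)
    (hν0 : ∫ e, e ∂ν = 0) (hν1 : Integrable (fun e : ℝ => e) ν)
    (hν2 : Integrable (fun e : ℝ => e ^ 2) ν) {f g : X → ℝ}
    (hfg : ∀ᵐ x ∂P.fst, f x = linPred φ b x + g x) (hg : MemLp g 2 P.fst) :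
    risk P f = ∫ x, g x ^ 2 ∂P.fst + ∫ e, e ^ 2 ∂ν := by
  have hb := measurable_linPred hφ b
  have hfst : ∀ᵐ z ∂P, f z.1 = linPred φ b z.1 + g z.1 := by
    rw [Measure.fst] at hfg
    exact ae_of_ae_map measurable_fst.aemeasurable hfg
  have hgP : AEStronglyMeasurable (fun z : X × ℝ => g z.1) P :=
    AEStronglyMeasurable.comp_aemeasurable (g := g) hg.1 measurable_fst.aemeasurable
  have hbm : AEStronglyMeasurable (fun z : X × ℝ => linPred φ b z.1) P :=
    (hb.comp measurable_fst).aestronglyMeasurable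
  have h1 : risk P f = ∫ z, (z.2 - (linPred φ b z.1 + g z.1)) ^ 2 ∂P := by
    refine integral_congr_ae ?_
    filter_upwards [hfst] with z hz
    rw [hz]
  have hmeas : AEStronglyMeasurable (fun z : X × ℝ => (z.2 - (linPred φ b z.1 + g z.1)) ^ 2) P :=
    ((measurable_snd.aestronglyMeasurable).sub (hbm.add hgP)).pow 2
  -- In the coordinates `(x, ε)` the law is a product, so the cross term of the expanded square
  -- vanishes with the noise mean.
  have h2 : ∫ z, (z.2 - (linPred φ b z.1 + g z.1)) ^ 2 ∂P =
      ∫ z, (z.2 - g z.1) ^ 2 ∂(P.fst.prod ν) := by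
    have hP' := hP
    unfold IsLinearModelWith at hP'
    rw [hP'] at hmeas
    conv_lhs => rw [hP']
    rw [integral_map (measurable_shear hφ b).aemeasurable hmeas]
    congr 1
    ext z
    ring
  have i1 : Integrable (fun z : X × ℝ => z.2 ^ 2) (P.fst.prod ν) := hν2.comp_snd _
  have i2 : Integrable (fun z : X × ℝ => g z.1 * z.2) (P.fst.prod ν) :=
    (hg.integrable one_le_two).mul_prod hν1
  have i3 : Integrable (fun z : X × ℝ => g z.1 ^ 2) (P.fst.prod ν) := hg.integrable_sq.comp_fst _
  have h3 : ∀ z : X × ℝ, (z.2 - g z.1) ^ 2 = (z.2 ^ 2 - 2 * (g z.1 * z.2)) + g z.1 ^ 2 :=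
    fun z => by ring
  have i12 : Integrable (fun z : X × ℝ => z.2 ^ 2 - 2 * (g z.1 * z.2)) (P.fst.prod ν) :=
    i1.sub (i2.const_mul 2)
  rw [h1, h2]
  simp only [h3]
  rw [integral_add i12 i3, integral_sub i1 (i2.const_mul 2), integral_const_mul,
    integral_prod_mul (fun x => g x) (fun e => e), hν0,
    integral_fun_fst (fun x => g x ^ 2), integral_fun_snd (fun e => e ^ 2)]
  simp
  ring

theorem excessLoss_linPred (hφ : Measurable φ) (hP : IsLinearModelWith P φ ν b)
    (hν0 : ∫ e, e ∂ν = 0) (hν1 : Integrable (fun e : ℝ => e) ν)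
    (hν2 : Integrable (fun e : ℝ => e ^ 2) ν) (h : ∀ j, MemLp (fun x => φ x j) 2 P.fst)
    (b' : Fin p → ℝ) :
    excessLoss P (linPred φ b') = (b' - b) ⬝ᵥ (featureCov P.fst φ *ᵥ (b' - b)) := by
  rw [excessLoss, risk_eq hφ hP hν0 hν1 hν2 (g := linPred φ (b' - b)) (f := linPred φ b')
    (Eventually.of_forall fun x => by simp [linPred, sub_dotProduct]) (memLp_linPred h _),
    risk_eq hφ hP hν0 hν1 hν2 (g := fun _ => 0) (f := regressionFunction P)
    (by simpa using regressionFunction_ae_eq hφ hP hν0 hν1) (memLp_const 0),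
    integral_linPred_sq h]
  simp

end LinearModel

/-! ### Whitened coordinates -/

section Whitening

variable {X : Type*} [MeasurableSpace X] {n p : ℕ} {Q : Measure X} {φ : X → Fin p → ℝ}

theorem sqrt_featureCov (h : (featureCov Q φ).PosDef) :
    CFC.sqrt (featureCov Q φ) * CFC.sqrt (featureCov Q φ) = featureCov Q φ ∧
    (CFC.sqrt (featureCov Q φ))ᵀ = CFC.sqrt (featureCov Q φ) ∧
    IsUnit (CFC.sqrt (featureCov Q φ)).det := by
  have h1 : CFC.sqrt (featureCov Q φ) * CFC.sqrt (featureCov Q φ) = featureCov Q φ :=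
    CFC.sqrt_mul_sqrt_self _ h.posSemidef.nonneg
  refine ⟨h1, ?_, ?_⟩
  · have := (CFC.sqrt_nonneg (featureCov Q φ)).posSemidef.isHermitian
    simpa [Matrix.IsHermitian, conjTranspose_eq_transpose_of_trivial] using this
  · have h2 := h.det_pos
    rw [← h1, det_mul] at h2
    exact isUnit_iff_ne_zero.2 fun h0 => by simp [h0] at h2

theorem sqrt_mulVec_dotProduct_self (h : (featureCov Q φ).PosDef) (v : Fin p → ℝ) :
    (CFC.sqrt (featureCov Q φ) *ᵥ v) ⬝ᵥ (CFC.sqrt (featureCov Q φ) *ᵥ v) =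
      v ⬝ᵥ (featureCov Q φ *ᵥ v) := by
  obtain ⟨h1, h2, -⟩ := sqrt_featureCov h
  conv_rhs => rw [← h1, ← mulVec_mulVec, dotProduct_mulVec, ← mulVec_transpose, h2]

theorem whitened_mulVec_sqrt (h : (featureCov Q φ).PosDef) (D : Fin n → X × ℝ) (v : Fin p → ℝ) :
    whitened Q φ D *ᵥ (CFC.sqrt (featureCov Q φ) *ᵥ v) = featureMatrix φ D *ᵥ v := by
  rw [whitened, mulVec_mulVec, Matrix.mul_assoc,
    nonsing_inv_mul _ (sqrt_featureCov h).2.2, Matrix.mul_one]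

theorem gram_eigenvalues_nonneg (Q : Measure X) (φ : X → Fin p → ℝ) (D : Fin n → X × ℝ)
    (i : Fin n) : 0 ≤ (gram_isHermitian Q φ D).eigenvalues i := by
  refine Matrix.PosSemidef.eigenvalues_nonneg (A := gram Q φ D) ?_ i
  have h := (posSemidef_self_mul_conjTranspose (whitened Q φ D)).smul
    (show (0 : ℝ) ≤ 1 / (p : ℝ) by positivity)
  rwa [conjTranspose_eq_transpose_of_trivial] at h

end Whitening

/-! ### The constrained minimisation for one data set -/

section FixedDesign

variable {X : Type*} [MeasurableSpace X] {n p : ℕ} {P : Measure (X × ℝ)}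
  {φ : X → Fin p → ℝ} {ν : Measure ℝ} {b : Fin p → ℝ} {σ τ : ℝ}

/-- The model assumptions for a single sample size. -/
structure RegressionModel (P : Measure (X × ℝ)) (φ : X → Fin p → ℝ) (ν : Measure ℝ)
    (b : Fin p → ℝ) : Prop where
  measurable_feature : Measurable φ
  memLp_feature : ∀ j, MemLp (fun x => φ x j) 2 P.fst
  posDef_cov : (featureCov P.fst φ).PosDef
  linear : IsLinearModelWith P φ ν b
  noise_mean : ∫ e, e ∂ν = 0
  noise_integrable : Integrable (fun e : ℝ => e) ν
  noise_integrable_sq : Integrable (fun e : ℝ => e ^ 2) ν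

theorem RegressionModel.mem_feasible_iff (h : RegressionModel P φ ν b) (D : Fin n → X × ℝ)
    (b' : Fin p → ℝ) : b' ∈ feasible φ σ τ D ↔ (1 / (n : ℝ)) *
      ((noise φ b D - whitened P.fst φ D *ᵥ (CFC.sqrt (featureCov P.fst φ) *ᵥ (b' - b))) ⬝ᵥ
        (noise φ b D - whitened P.fst φ D *ᵥ (CFC.sqrt (featureCov P.fst φ) *ᵥ (b' - b)))) ≤
      τ * σ ^ 2 := by
  rw [whitened_mulVec_sqrt h.posDef_cov, ← trainLoss_linPred]
  rfl

theorem RegressionModel.exists_sqrt_mulVec_eq (h : RegressionModel P φ ν b) (θ : Fin p → ℝ) :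
    ∃ b', CFC.sqrt (featureCov P.fst φ) *ᵥ (b' - b) = θ :=
  ⟨b + (CFC.sqrt (featureCov P.fst φ))⁻¹ *ᵥ θ, by
    rw [add_sub_cancel_left, mulVec_mulVec, mul_nonsing_inv _ (sqrt_featureCov h.posDef_cov).2.2,
      one_mulVec]⟩

variable [IsProbabilityMeasure P] [IsProbabilityMeasure ν]

theorem RegressionModel.excessLoss_eq (h : RegressionModel P φ ν b) (b' : Fin p → ℝ) :
    excessLoss P (linPred φ b') =
      (CFC.sqrt (featureCov P.fst φ) *ᵥ (b' - b)) ⬝ᵥ (CFC.sqrt (featureCov P.fst φ) *ᵥ (b' - b)) := by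
  rw [excessLoss_linPred h.measurable_feature h.linear h.noise_mean h.noise_integrable
    h.noise_integrable_sq h.memLp_feature, sqrt_mulVec_dotProduct_self h.posDef_cov]

/-- In whitened coordinates a minimiser is a point of a closed set nearest to the origin, and
invertibility of the square root pulls it back to a coefficient vector. -/
theorem RegressionModel.exists_minimizer (h : RegressionModel P φ ν b) (D : Fin n → X × ℝ)
    (hne : (feasible φ σ τ D).Nonempty) :
    ∃ b₀ ∈ feasible φ σ τ D, ∀ b' ∈ feasible φ σ τ D,
      excessLoss P (linPred φ b₀) ≤ excessLoss P (linPred φ b') := by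
  set S := CFC.sqrt (featureCov P.fst φ) with hS
  -- `EuclideanSpace` is essential: on `Fin p → ℝ` the distance is the sup distance, whereas the
  -- excess loss is the squared `ℓ²` norm.
  let F : Set (EuclideanSpace ℝ (Fin p)) := {θ | (1 / (n : ℝ)) *
      ((noise φ b D - whitened P.fst φ D *ᵥ θ.ofLp) ⬝ᵥ
        (noise φ b D - whitened P.fst φ D *ᵥ θ.ofLp)) ≤ τ * σ ^ 2}
  have hF : IsClosed F := isClosed_le
    (by unfold dotProduct; simp only [Pi.sub_apply, mulVec, dotProduct]; fun_prop) continuous_const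
  have hmem : ∀ b', b' ∈ feasible φ σ τ D ↔ WithLp.toLp 2 (S *ᵥ (b' - b)) ∈ F :=
    fun b' => h.mem_feasible_iff D b'
  obtain ⟨b₁, hb₁⟩ := hne
  obtain ⟨θ₀, hθ₀, hdist⟩ := hF.exists_infDist_eq_dist ⟨_, (hmem b₁).1 hb₁⟩ 0
  obtain ⟨b₀, hb₀⟩ := h.exists_sqrt_mulVec_eq θ₀.ofLp
  have hb₀' : b₀ ∈ feasible φ σ τ D := by
    rw [hmem, hS, hb₀]
    exact hθ₀
  refine ⟨b₀, hb₀', fun b' hb' => ?_⟩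
  have h1 := Metric.infDist_le_dist_of_mem (x := 0) ((hmem b').1 hb')
  rw [hdist, dist_zero_left, dist_zero_left] at h1
  have hsq : ∀ θ : EuclideanSpace ℝ (Fin p), θ.ofLp ⬝ᵥ θ.ofLp = ‖θ‖ ^ 2 := fun θ => by
    rw [EuclideanSpace.norm_sq_eq]
    simp [dotProduct, sq]
  have h2 := hsq (WithLp.toLp 2 (S *ᵥ (b' - b)))
  rw [h.excessLoss_eq, h.excessLoss_eq, ← hS, hb₀, hsq]
  exact (pow_le_pow_left₀ (norm_nonneg _) h1 2).trans_eq h2.symm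

theorem minExcessLoss_eq_of_isMin {D : Fin n → X × ℝ} {b₀ : Fin p → ℝ} (h₀ : b₀ ∈ feasible φ σ τ D)
    (hmin : ∀ b' ∈ feasible φ σ τ D, excessLoss P (linPred φ b₀) ≤ excessLoss P (linPred φ b')) :
    minExcessLoss P φ σ τ D = ((excessLoss P (linPred φ b₀) : ℝ) : EReal) :=
  le_antisymm (iInf₂_le b₀ h₀) (le_iInf₂ fun b' hb' => EReal.coe_le_coe_iff.2 (hmin b' hb'))

/-- Training loss of the ridge estimator. -/
noncomputable def ridgeTrain (Q : Measure X) (φ : X → Fin p → ℝ) (b : Fin p → ℝ)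
    (D : Fin n → X × ℝ) (ρ : ℝ) : ℝ :=
  (1 / (n : ℝ)) * (ρ ^ 2 * (noise φ b D ⬝ᵥ ((resolventMatrix (gram Q φ D) ρ ^ 2) *ᵥ noise φ b D)))

/-- Excess loss of the ridge estimator. -/
noncomputable def ridgeExcess (Q : Measure X) (φ : X → Fin p → ℝ) (b : Fin p → ℝ)
    (D : Fin n → X × ℝ) (ρ : ℝ) : ℝ :=
  (1 / (p : ℝ)) * (noise φ b D ⬝ᵥ (resolventMatrix (gram Q φ D) ρ *ᵥ noise φ b D) -
    ρ * (noise φ b D ⬝ᵥ ((resolventMatrix (gram Q φ D) ρ ^ 2) *ᵥ noise φ b D)))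

/-- Upper half of the sandwich: a ridge solution that meets the constraint is a competitor. -/
theorem RegressionModel.exists_feasible_ridge (h : RegressionModel P φ ν b) (D : Fin n → X × ℝ)
    {ρ : ℝ} (hρ : 0 < ρ) (hle : ridgeTrain P.fst φ b D ρ ≤ τ * σ ^ 2) :
    ∃ b' ∈ feasible φ σ τ D, excessLoss P (linPred φ b') = ridgeExcess P.fst φ b D ρ := by
  have hG := gram_isHermitian P.fst φ D
  have hpos := gram_eigenvalues_nonneg P.fst φ D
  obtain ⟨b', hb'⟩ := h.exists_sqrt_mulVec_eq (ridge (whitened P.fst φ D) ρ (noise φ b D))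
  refine ⟨b', ?_, ?_⟩
  · rw [h.mem_feasible_iff, hb', ridge_residual_sq hG hpos hρ]
    exact hle
  · rw [h.excessLoss_eq, hb', ridge_sq hG hpos hρ]
    rfl

/-- Lower half of the sandwich: every feasible vector fits at least as well as a ridge solution on
or above the constraint level, so `ridge_optimal` applies. -/
theorem RegressionModel.ridgeExcess_le (h : RegressionModel P φ ν b) (D : Fin n → X × ℝ)
    {ρ : ℝ} (hρ : 0 < ρ) (hn : 0 < n) (hp : 0 < p) (hle : τ * σ ^ 2 ≤ ridgeTrain P.fst φ b D ρ)
    {b' : Fin p → ℝ} (hb' : b' ∈ feasible φ σ τ D) :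
    ridgeExcess P.fst φ b D ρ ≤ excessLoss P (linPred φ b') := by
  have hG := gram_isHermitian P.fst φ D
  have hpos := gram_eigenvalues_nonneg P.fst φ D
  rw [h.mem_feasible_iff] at hb'
  have h1 := ridge_optimal hG hpos hρ hp (noise φ b D)
    (CFC.sqrt (featureCov P.fst φ) *ᵥ (b' - b)) (by
      rw [ridge_residual_sq hG hpos hρ]
      have hn' : (0 : ℝ) < 1 / n := by positivity
      exact le_of_mul_le_mul_left (hb'.trans hle) hn')
  rw [h.excessLoss_eq]
  refine le_trans (le_of_eq ?_) h1
  rw [ridge_sq hG hpos hρ]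
  rfl

theorem RegressionModel.excessLoss_nonneg (h : RegressionModel P φ ν b) (b' : Fin p → ℝ) :
    0 ≤ excessLoss P (linPred φ b') := by
  rw [h.excessLoss_eq]
  exact Finset.sum_nonneg fun i _ => mul_self_nonneg _

theorem RegressionModel.minimizer_of_noise_eq_zero (h : RegressionModel P φ ν b)
    {D : Fin n → X × ℝ} (hD : noise φ b D = 0) (hσ : σ = 0) :
    b ∈ feasible φ σ τ D ∧ excessLoss P (linPred φ b) = 0 := by
  constructor
  · rw [h.mem_feasible_iff, hD, sub_self, mulVec_zero, mulVec_zero, hσ]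
    simp
  · rw [h.excessLoss_eq]
    simp

end FixedDesign

/-! ### Measurability of resolvent entries in the inputs -/

section Measurability

variable {α : Type*} [MeasurableSpace α] {n p : ℕ}

theorem measurable_det {M : α → Matrix (Fin n) (Fin n) ℝ}
    (hM : ∀ i j, Measurable fun x => M x i j) : Measurable fun x => (M x).det := by
  simp only [det_apply]
  refine Finset.measurable_fun_sum _ fun s _ => ?_
  exact (Finset.measurable_fun_prod _ fun i _ => hM _ _).const_smul _

/-- Cramer's rule writes the entry through determinants; singular matrices need no separate case
because `0⁻¹ = 0`. -/
theorem measurable_inv_apply {M : α → Matrix (Fin n) (Fin n) ℝ}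
    (hM : ∀ i j, Measurable fun x => M x i j) (i j : Fin n) :
    Measurable fun x => (M x)⁻¹ i j := by
  have e : ∀ x, (M x)⁻¹ i j = (M x).det⁻¹ * ((M x).updateRow j (Pi.single i 1)).det := fun x => by
    rw [inv_def, Matrix.smul_apply, adjugate_apply, Ring.inverse_eq_inv', smul_eq_mul]
  simp only [e]
  refine (measurable_det hM).inv.mul (measurable_det fun i' j' => ?_)
  simp only [updateRow_apply]
  by_cases h : i' = j
  · simp [h]
  · simpa [h] using hM i' j'

theorem measurable_pow_apply {M : α → Matrix (Fin n) (Fin n) ℝ}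
    (hM : ∀ i j, Measurable fun x => M x i j) (k : ℕ) (i j : Fin n) :
    Measurable fun x => (M x ^ k) i j := by
  induction k generalizing i j with
  | zero => simp only [pow_zero]; exact measurable_const
  | succ k ih =>
    simp only [pow_succ, mul_apply]
    exact Finset.measurable_fun_sum _ fun l _ => (ih i l).mul (hM l j)

/-- The Gram matrix reads only the inputs; the dummy label 0 displays it as a function of them
alone, as conditioning on the inputs requires. -/
theorem measurable_resolventMatrix_gram {X : Type*} [MeasurableSpace X] (Q : Measure X)
    {φ : X → Fin p → ℝ} (hφ : Measurable φ) (ρ : ℝ) (k : ℕ) (i j : Fin n) :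
    Measurable fun x : Fin n → X =>
      (resolventMatrix (gram Q φ fun i => (x i, 0)) ρ ^ k) i j := by
  have hφ' : ∀ (i : Fin n) (j : Fin p), Measurable fun x : Fin n → X => φ (x i) j := fun i j =>
    (measurable_pi_apply j).comp (hφ.comp (measurable_pi_apply i))
  have hW : ∀ i j, Measurable fun x : Fin n → X => whitened Q φ (fun i => (x i, 0)) i j := by
    intro i j
    simp only [whitened, mul_apply]
    exact Finset.measurable_fun_sum _ fun l _ => (hφ' i l).mul_const _
  have hG : ∀ i j, Measurable fun x : Fin n → X => gram Q φ (fun i => (x i, 0)) i j := by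
    intro i j
    simp only [gram, Matrix.smul_apply, mul_apply, transpose_apply, smul_eq_mul]
    exact (Finset.measurable_fun_sum _ fun l _ => (hW i l).mul (hW j l)).const_mul _
  refine measurable_pow_apply (fun i j => measurable_inv_apply (fun i j => ?_) i j) k i j
  simp only [Matrix.add_apply]
  exact (hG i j).add_const _

end Measurability

/-! ### The joint law of input and noise -/

section Law

variable {X : Type*} [MeasurableSpace X] {p : ℕ} {P : Measure (X × ℝ)} {φ : X → Fin p → ℝ}
  {ν : Measure ℝ} {b : Fin p → ℝ}

theorem measurePreserving_noise (hφ : Measurable φ) (hP : IsLinearModelWith P φ ν b) :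
    MeasurePreserving (fun z : X × ℝ => (z.1, z.2 - linPred φ b z.1)) P (P.fst.prod ν) := by
  have hb := measurable_linPred hφ b
  have hm : Measurable fun z : X × ℝ => (z.1, z.2 - linPred φ b z.1) := by fun_prop
  refine ⟨hm, ?_⟩
  have hP' := hP
  unfold IsLinearModelWith at hP'
  conv_lhs => rw [hP']
  rw [Measure.map_map hm (measurable_shear hφ b)]
  convert Measure.map_id
  ext z <;> simp

end Law

/-! ### Tail bounds by conditioning on the inputs -/

section NoiseLaw

variable {X : Type*} [MeasurableSpace X] {n p : ℕ} {P : Measure (X × ℝ)} [IsProbabilityMeasure P]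
  {φ : X → Fin p → ℝ} {ν : Measure ℝ} [IsProbabilityMeasure ν] {b : Fin p → ℝ} {σ τ η : ℝ}

theorem measurePreserving_noise_vector (hφ : Measurable φ) (hP : IsLinearModelWith P φ ν b) :
    MeasurePreserving (fun D : Fin n → X × ℝ => ((fun i => (D i).1), noise φ b D))
      (Measure.pi fun _ => P) ((Measure.pi fun _ => P.fst).prod (Measure.pi fun _ => ν)) :=
  (measurePreserving_arrowProdEquivProdArrow X ℝ (Fin n) (fun _ => P.fst) (fun _ => ν)).comp
    (measurePreserving_pi (fun _ => P) (fun _ => P.fst.prod ν)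
      fun _ => measurePreserving_noise hφ hP)

/-- Inputs and noise vector have a product law, so a bound uniform in the inputs integrates to the
same bound by Tonelli. -/
theorem measure_noise_event_le {Ω : Type*} [MeasurableSpace Ω] {μ : Measure Ω}
    {D : Ω → Fin n → X × ℝ} (hD : HasLaw D (Measure.pi fun _ => P) μ)
    (hφ : Measurable φ) (hP : IsLinearModelWith P φ ν b)
    {E : Set ((Fin n → X) × (Fin n → ℝ))} (hE : MeasurableSet E) {B : ℝ}
    (hB : ∀ x, (Measure.pi fun _ : Fin n => ν).real {e | (x, e) ∈ E} ≤ B) :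
    μ {ω | ((fun i => (D ω i).1), noise φ b (D ω)) ∈ E} ≤ ENNReal.ofReal B := by
  have hmp := measurePreserving_noise_vector (n := n) hφ hP
  have h1 : μ {ω | ((fun i => (D ω i).1), noise φ b (D ω)) ∈ E} =
      (Measure.pi fun _ => P) {D' | ((fun i => (D' i).1), noise φ b D') ∈ E} := by
    rw [← hD.map_eq]
    exact (Measure.map_apply_of_aemeasurable hD.aemeasurable (hmp.measurable hE)).symm
  have h2 : (Measure.pi fun _ => P) {D' : Fin n → X × ℝ | ((fun i => (D' i).1), noise φ b D') ∈ E} =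
      ((Measure.pi fun _ => P.fst).prod (Measure.pi fun _ => ν)) E :=
    hmp.measure_preimage hE.nullMeasurableSet
  rw [h1, h2, Measure.prod_apply hE]
  calc _ ≤ ∫⁻ _x : Fin n → X, ENNReal.ofReal B ∂(Measure.pi fun _ => P.fst) := by
        refine lintegral_mono fun x => ?_
        rw [← ofReal_measureReal]
        exact ENNReal.ofReal_le_ofReal (hB x)
    _ = _ := by simp

theorem gram_fst (Q : Measure X) (φ : X → Fin p → ℝ) (D : Fin n → X × ℝ) :
    (gram Q φ fun i => ((D i).1, 0)) = gram Q φ D := rfl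

/-- `K` is chosen before the dimensions, the distribution and the features, so one constant serves
every `k` in the Borel-Cantelli sum. -/
theorem noise_quadForm_tail (hη : 0 < η) (hν_mean : ∫ e, e ∂ν = 0)
    (hν_var : ∫ e, e ^ 2 ∂ν = σ ^ 2) (hν : Integrable (fun e : ℝ => |e| ^ (4 + η)) ν)
    {ρ δ : ℝ} (hρ : 0 < ρ) (hδ : 0 < δ) (j : ℕ) :
    ∃ K : ℝ, 0 ≤ K ∧ ∀ {d n p : ℕ} {P : Measure ((Fin d → ℝ) × ℝ)} [IsProbabilityMeasure P]
      {φ : (Fin d → ℝ) → Fin p → ℝ} {b : Fin p → ℝ} {Ω : Type*} [MeasurableSpace Ω] {μ : Measure Ω}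
      {D : Ω → Fin n → (Fin d → ℝ) × ℝ}, HasLaw D (Measure.pi fun _ => P) μ → Measurable φ →
      IsLinearModelWith P φ ν b → 1 ≤ n → |σ| ≤ (n : ℝ) ^ (1 / 8 : ℝ) →
      μ {ω | δ * n ≤ |noise φ b (D ω) ⬝ᵥ
          ((resolventMatrix (gram P.fst φ (D ω)) ρ ^ j) *ᵥ noise φ b (D ω)) -
          σ ^ 2 * (resolventMatrix (gram P.fst φ (D ω)) ρ ^ j).trace|} ≤
        ENNReal.ofReal (K * ((n : ℝ) ^ (-3 / 2 : ℝ) + (n : ℝ) ^ (-(1 + η / 8)))) := by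
  obtain ⟨K, hK, h⟩ := quadForm_tail_bound hη hν_mean hν_var hν
    (C := (1 / ρ) ^ (2 * j)) (δ := δ) (by positivity) hδ
  refine ⟨K, hK, fun {d n p P} _ {φ b Ω} _ {μ D} hD hφ hP hn hσ => ?_⟩
  have hR := fun i l => measurable_resolventMatrix_gram (n := n) P.fst hφ ρ j i l
  have hR' : ∀ i l, Measurable fun q : (Fin n → Fin d → ℝ) × (Fin n → ℝ) =>
      (resolventMatrix (gram P.fst φ fun i => (q.1 i, 0)) ρ ^ j) i l :=
    fun i l => (hR i l).comp measurable_fst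
  have key := measure_noise_event_le hD hφ hP (E := {q | δ * n ≤ |q.2 ⬝ᵥ
      ((resolventMatrix (gram P.fst φ fun i => (q.1 i, 0)) ρ ^ j) *ᵥ q.2) -
      σ ^ 2 * (resolventMatrix (gram P.fst φ fun i => (q.1 i, 0)) ρ ^ j).trace|})
    (B := K * ((n : ℝ) ^ (-3 / 2 : ℝ) + (n : ℝ) ^ (-(1 + η / 8)))) ?_ fun x => ?_
  · simpa only [Set.mem_ofPred_eq, gram_fst] using key
  · refine measurableSet_le measurable_const ?_
    simp only [dotProduct, mulVec, trace, diag]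
    refine Measurable.abs (Measurable.sub ?_ ?_)
    · refine Finset.measurable_fun_sum _ fun i _ => Measurable.mul (by fun_prop) ?_
      exact Finset.measurable_fun_sum _ fun l _ => (hR' i l).mul (by fun_prop)
    · exact (Finset.measurable_fun_sum _ fun i _ => hR' i i).const_mul _
  · have := h n hn hσ (resolventMatrix (gram P.fst φ fun i => (x i, 0)) ρ ^ j)
      (sum_sq_entries_resolventMatrix_pow_le (gram_isHermitian P.fst φ fun i => (x i, 0))
        (gram_eigenvalues_nonneg P.fst φ fun i => (x i, 0)) hρ j)
    simpa only [Set.mem_ofPred_eq] using this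

end NoiseLaw

/-! ### Almost sure limits along the sequence -/

section Asymptotics

/-- A strictly increasing sequence of naturals dominates its index, and the limiting ratio carries
this from `p` to `n`. Divergence of `n` alone would not make the tail bounds summable over `k`. -/
theorem exists_linear_growth {n p : ℕ → ℕ} {γ : ℝ} (hγ : 0 < γ)
    (hmono : StrictMono n ∨ StrictMono p)
    (hnp : Tendsto (fun k => (n k : ℝ) / (p k : ℝ)) atTop (𝓝 γ)) :
    ∃ c : ℝ, 0 < c ∧ ∀ᶠ k : ℕ in atTop, c * k ≤ n k := by
  rcases hmono with h | h
  · exact ⟨1, one_pos, Eventually.of_forall fun k => by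
      rw [one_mul]; exact_mod_cast h.le_apply⟩
  · refine ⟨γ / 2, by positivity, ?_⟩
    filter_upwards [hnp.eventually (lt_mem_nhds (half_lt_self hγ)), eventually_gt_atTop 0]
      with k hk hk0
    have hkp : (k : ℝ) ≤ p k := by exact_mod_cast h.le_apply
    have hk0' : (0 : ℝ) < k := by exact_mod_cast hk0
    rw [lt_div_iff₀ (hk0'.trans_le hkp)] at hk
    exact le_trans (by gcongr) hk.le

theorem summable_rpow_of_linear_growth {n : ℕ → ℕ} {c : ℝ} (hc : 0 < c)
    (h : ∀ᶠ k : ℕ in atTop, c * k ≤ n k) {s : ℝ} (hs : s < -1) :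
    Summable fun k => (n k : ℝ) ^ s := by
  refine Summable.of_norm_bounded_eventually_nat (g := fun k : ℕ => c ^ s * (k : ℝ) ^ s)
    ((Real.summable_nat_rpow.2 hs).mul_left _) ?_
  filter_upwards [h, eventually_gt_atTop 0] with k hk hk0
  have hk0' : (0 : ℝ) < k := by exact_mod_cast hk0
  rw [Real.norm_of_nonneg (by positivity), ← Real.mul_rpow hc.le hk0'.le]
  exact Real.rpow_le_rpow_of_nonpos (by positivity) hk (by linarith)

/-- Each bound holds only from an index depending on `m`, so `k → ∞` is taken first and `m → ∞`
afterwards. -/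
theorem tendsto_of_sandwich {α : Type*} [TopologicalSpace α] [LinearOrder α] [OrderTopology α]
    {f : ℕ → α} {lo hi : ℕ → ℕ → α} {Lo Hi : ℕ → α} {L : α}
    (hlo : ∀ m, ∀ᶠ k in atTop, lo m k ≤ f k) (hhi : ∀ m, ∀ᶠ k in atTop, f k ≤ hi m k)
    (tlo : ∀ m, Tendsto (lo m) atTop (𝓝 (Lo m))) (thi : ∀ m, Tendsto (hi m) atTop (𝓝 (Hi m)))
    (hLo : Tendsto Lo atTop (𝓝 L)) (hHi : Tendsto Hi atTop (𝓝 L)) : Tendsto f atTop (𝓝 L) := by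
  refine tendsto_order.2 ⟨fun a ha => ?_, fun a ha => ?_⟩
  · obtain ⟨m, hm⟩ := (hLo.eventually (lt_mem_nhds ha)).exists
    filter_upwards [hlo m, (tlo m).eventually (lt_mem_nhds hm)] with k h1 h2 using h2.trans_le h1
  · obtain ⟨m, hm⟩ := (hHi.eventually (gt_mem_nhds ha)).exists
    filter_upwards [hhi m, (thi m).eventually (gt_mem_nhds hm)] with k h1 h2 using h1.trans_lt h2

variable {Ω : Type*} {n p d : ℕ → ℕ} {P : (k : ℕ) → Measure ((Fin (d k) → ℝ) × ℝ)}
  {φ : (k : ℕ) → (Fin (d k) → ℝ) → Fin (p k) → ℝ}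
  {D : (k : ℕ) → Ω → Fin (n k) → (Fin (d k) → ℝ) × ℝ}
  {σ η γ : ℝ} {b : (k : ℕ) → Fin (p k) → ℝ}

theorem tendsto_noise_quadForm {ω : Ω} {ρ : ℝ} (hρ : 0 < ρ) (j : ℕ)
    (hMP : WeaklyConverges
      (fun k => esd (gram_isHermitian (P k).fst (φ k) (D k ω))) (marchenkoPastur γ))
    (h : Tendsto (fun k => (n k : ℝ)⁻¹ * (noise (φ k) (b k) (D k ω) ⬝ᵥ
          ((resolventMatrix (gram (P k).fst (φ k) (D k ω)) ρ ^ j) *ᵥ noise (φ k) (b k) (D k ω)) -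
          σ ^ 2 * (resolventMatrix (gram (P k).fst (φ k) (D k ω)) ρ ^ j).trace)) atTop (𝓝 0)) :
    Tendsto (fun k => (n k : ℝ)⁻¹ * (noise (φ k) (b k) (D k ω) ⬝ᵥ
          ((resolventMatrix (gram (P k).fst (φ k) (D k ω)) ρ ^ j) *ᵥ noise (φ k) (b k) (D k ω))))
      atTop (𝓝 (σ ^ 2 * ∫ s, (1 / (s + ρ)) ^ j ∂(marchenkoPastur γ))) := by
  have h2 := tendsto_trace_resolventMatrix_pow
    (fun k => gram_isHermitian (P k).fst (φ k) (D k ω))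
    (fun k => gram_eigenvalues_nonneg (P k).fst (φ k) (D k ω)) (marchenkoPastur_ae_nonneg γ) hMP hρ j
  have h3 := h.add (h2.const_mul (σ ^ 2))
  rw [zero_add] at h3
  refine h3.congr fun k => ?_
  ring

variable [MeasurableSpace Ω] {μ : Measure Ω} [∀ k, IsProbabilityMeasure (P k)]
  {ν : Measure ℝ} [IsProbabilityMeasure ν]

theorem ae_noise_eq_zero (hφ : ∀ k, Measurable (φ k))
    (hD : ∀ k, HasLaw (D k) (Measure.pi fun _ => P k) μ)
    (hP : ∀ k, IsLinearModelWith (P k) (φ k) ν (b k)) (h0 : ∀ᵐ e ∂ν, e = 0) :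
    ∀ᵐ ω ∂μ, ∀ k, noise (φ k) (b k) (D k ω) = 0 := by
  refine ae_all_iff.2 fun k => ?_
  have h1 : ∀ᵐ e ∂(Measure.pi fun _ : Fin (n k) => ν), e = 0 := by
    have : ∀ᵐ e ∂(Measure.pi fun _ : Fin (n k) => ν), ∀ i, e i = 0 := ae_all_iff.2 fun i =>
      (measurePreserving_eval (fun _ : Fin (n k) => ν) i).quasiMeasurePreserving.ae h0
    exact this.mono fun e he => funext he
  have h2 := measure_noise_event_le (hD k) (hφ k) (hP k)
    (E := {q | ¬ q.2 = 0}) (measurable_snd (measurableSet_singleton 0)).compl (B := 0) fun x => by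
      rw [measureReal_def]
      have : (Measure.pi fun _ : Fin (n k) => ν) {e | ¬ e = 0} = 0 := h1
      exact (congrArg ENNReal.toReal this).le
  rw [ENNReal.ofReal_zero] at h2
  exact le_antisymm h2 bot_le

variable [IsProbabilityMeasure μ]

/-- Borel-Cantelli at each threshold `1/(m+1)`. Only the convergence half is used, so the joint law
over different `k` is irrelevant. -/
theorem ae_tendsto_noise_quadForm (hn : Tendsto n atTop atTop) {c : ℝ} (hc : 0 < c)
    (hgrow : ∀ᶠ k : ℕ in atTop, c * k ≤ n k) (hφ : ∀ k, Measurable (φ k))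
    (hD : ∀ k, HasLaw (D k) (Measure.pi fun _ => P k) μ) (hη : 0 < η)
    (hν_mean : ∫ e, e ∂ν = 0) (hν_var : ∫ e, e ^ 2 ∂ν = σ ^ 2)
    (hν : Integrable (fun e : ℝ => |e| ^ (4 + η)) ν)
    (hP : ∀ k, IsLinearModelWith (P k) (φ k) ν (b k)) {ρ : ℝ} (hρ : 0 < ρ) (j : ℕ) :
    ∀ᵐ ω ∂μ, Tendsto (fun k => (n k : ℝ)⁻¹ * (noise (φ k) (b k) (D k ω) ⬝ᵥ
          ((resolventMatrix (gram (P k).fst (φ k) (D k ω)) ρ ^ j) *ᵥ noise (φ k) (b k) (D k ω)) -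
          σ ^ 2 * (resolventMatrix (gram (P k).fst (φ k) (D k ω)) ρ ^ j).trace)) atTop (𝓝 0) := by
  set T : ℕ → Ω → ℝ := fun k ω => noise (φ k) (b k) (D k ω) ⬝ᵥ
          ((resolventMatrix (gram (P k).fst (φ k) (D k ω)) ρ ^ j) *ᵥ noise (φ k) (b k) (D k ω)) -
          σ ^ 2 * (resolventMatrix (gram (P k).fst (φ k) (D k ω)) ρ ^ j).trace with hT
  have hn' : Tendsto (fun k => (n k : ℝ)) atTop atTop := tendsto_natCast_atTop_atTop.comp hn
  have key : ∀ m : ℕ, ∀ᵐ ω ∂μ, ∀ᶠ k in atTop, |T k ω| < 1 / ((m : ℝ) + 1) * n k := by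
    intro m
    obtain ⟨K, hK, h⟩ := noise_quadForm_tail hη hν_mean hν_var hν hρ
      (show (0 : ℝ) < 1 / ((m : ℝ) + 1) by positivity) j
    have hsum : Summable fun k => μ.real {ω | 1 / ((m : ℝ) + 1) * n k ≤ |T k ω|} := by
      refine Summable.of_norm_bounded_eventually_nat (((summable_rpow_of_linear_growth hc hgrow
        (by norm_num : (-3 / 2 : ℝ) < -1)).add (summable_rpow_of_linear_growth hc hgrow
        (by linarith : -(1 + η / 8) < -1))).mul_left K) ?_
      filter_upwards [hn.eventually_ge_atTop 1,
        ((tendsto_rpow_atTop (by norm_num : (0 : ℝ) < 1 / 8)).comp hn').eventually_ge_atTop |σ|]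
        with k hk1 hk2
      rw [Real.norm_of_nonneg measureReal_nonneg]
      exact ENNReal.toReal_le_of_le_ofReal (by positivity)
        (h (hD k) (hφ k) (hP k) hk1 hk2)
    have hfin : ∑' k, μ {ω | 1 / ((m : ℝ) + 1) * n k ≤ |T k ω|} ≠ ∞ := by
      rw [← tsum_congr fun k =>
        ofReal_measureReal (μ := μ) (s := {ω | 1 / ((m : ℝ) + 1) * n k ≤ |T k ω|})]
      exact hsum.tsum_ofReal_ne_top
    filter_upwards [ae_eventually_notMem hfin] with ω hω
    exact hω.mono fun k hk => not_le.1 hk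
  filter_upwards [ae_all_iff.2 key] with ω hω
  rw [Metric.tendsto_nhds]
  intro ε hε
  obtain ⟨m, hm⟩ := exists_nat_one_div_lt hε
  filter_upwards [hω m, hn.eventually_ge_atTop 1] with k hk hk1
  have hk0 : (0 : ℝ) < n k := by exact_mod_cast hk1
  rw [Real.dist_eq, sub_zero, abs_mul, abs_of_pos (inv_pos.2 hk0), ← div_eq_inv_mul]
  exact ((div_lt_iff₀ hk0).2 hk).trans hm

theorem ae_tendsto_ridge (hγ : 0 < γ) (hn : Tendsto n atTop atTop)
    (hmono : StrictMono n ∨ StrictMono p)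
    (hnp : Tendsto (fun k => (n k : ℝ) / (p k : ℝ)) atTop (𝓝 γ))
    (hφ : ∀ k, Measurable (φ k))
    (hD : ∀ k, HasLaw (D k) (Measure.pi fun _ => P k) μ)
    (hMP : ∀ᵐ ω ∂μ, WeaklyConverges
      (fun k => esd (gram_isHermitian (P k).fst (φ k) (D k ω))) (marchenkoPastur γ))
    [IsFiniteMeasure (marchenkoPastur γ)] (hη : 0 < η)
    (hν_mean : ∫ e, e ∂ν = 0) (hν_var : ∫ e, e ^ 2 ∂ν = σ ^ 2)
    (hν : Integrable (fun e : ℝ => |e| ^ (4 + η)) ν)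
    (hP : ∀ k, IsLinearModelWith (P k) (φ k) ν (b k)) {ρ : ℝ} (hρ : 0 < ρ) :
    ∀ᵐ ω ∂μ,
      Tendsto (fun k => ridgeTrain (P k).fst (φ k) (b k) (D k ω) ρ) atTop
        (𝓝 (ridgeLoss (marchenkoPastur γ) ρ * σ ^ 2)) ∧
      Tendsto (fun k => ridgeExcess (P k).fst (φ k) (b k) (D k ω) ρ) atTop
        (𝓝 (σ ^ 2 * γ * (mpStieltjes γ (-ρ) - ρ * deriv (mpStieltjes γ) (-ρ)))) := by
  obtain ⟨c, hc, hgrow⟩ := exists_linear_growth hγ hmono hnp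
  filter_upwards [hMP,
    ae_tendsto_noise_quadForm hn hc hgrow hφ hD hη hν_mean hν_var hν hP hρ 1,
    ae_tendsto_noise_quadForm hn hc hgrow hφ hD hη hν_mean hν_var hν hP hρ 2] with ω h0 h1 h2
  have t1 := tendsto_noise_quadForm hρ 1 h0 h1
  have t2 := tendsto_noise_quadForm hρ 2 h0 h2
  constructor
  · have := t2.const_mul (ρ ^ 2)
    rw [ridgeLoss_eq]
    convert this using 2
    · rw [ridgeTrain]; ring
    · ring
  -- The excess loss is normalised by `p` but the traces by `n`; the ratio `n/p` is where `γ`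
  -- enters.
  · have := hnp.mul (t1.sub (t2.const_mul ρ))
    rw [(hasDerivAt_mpStieltjes hρ).deriv]
    have e : mpStieltjes γ (-ρ) = ∫ s, (1 / (s + ρ)) ^ 1 ∂(marchenkoPastur γ) := by
      simp only [mpStieltjes, sub_neg_eq_add, pow_one]
    rw [e]
    refine Tendsto.congr' ?_ (this.trans_eq ?_)
    · filter_upwards [hn.eventually_gt_atTop 0] with k hk
      have hk0 : (n k : ℝ) ≠ 0 := by exact_mod_cast hk.ne'
      rw [ridgeExcess, pow_one]
      field_simp
    · congr 1
      ring

theorem ae_tendsto_minExcessLoss (hγ : 0 < γ) (hn : Tendsto n atTop atTop)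
    (hp : Tendsto p atTop atTop) (hmono : StrictMono n ∨ StrictMono p)
    (hnp : Tendsto (fun k => (n k : ℝ) / (p k : ℝ)) atTop (𝓝 γ))
    (hM : ∀ k, RegressionModel (P k) (φ k) ν (b k))
    (hD : ∀ k, HasLaw (D k) (Measure.pi fun _ => P k) μ)
    (hMP : ∀ᵐ ω ∂μ, WeaklyConverges
      (fun k => esd (gram_isHermitian (P k).fst (φ k) (D k ω))) (marchenkoPastur γ))
    [IsProbabilityMeasure (marchenkoPastur γ)] (hη : 0 < η)
    (hν_var : ∫ e, e ^ 2 ∂ν = σ ^ 2) (hν : Integrable (fun e : ℝ => |e| ^ (4 + η)) ν)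
    (hσ : σ ≠ 0) {l : ℝ} (hl : 0 < l) :
    ∀ᵐ ω ∂μ,
      (∀ᶠ k in atTop, (feasible (φ k) σ (ridgeLoss (marchenkoPastur γ) l) (D k ω)).Nonempty) ∧
      Tendsto (fun k => minExcessLoss (P k) (φ k) σ (ridgeLoss (marchenkoPastur γ) l) (D k ω)) atTop
        (𝓝 ((σ ^ 2 * γ *
          (mpStieltjes γ (-l) - l * deriv (mpStieltjes γ) (-l)) : ℝ) : EReal)) := by
  have hmp0 := marchenkoPastur_ae_nonneg γ
  have hatom : (marchenkoPastur γ).real {0} < 1 := by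
    rw [marchenkoPastur_real_zero]
    have : 0 < 1 / γ := by positivity
    exact max_lt one_pos (by linarith)
  have hmonoLoss := ridgeLoss_strictMonoOn hmp0 hatom
  have hσ2 : 0 < σ ^ 2 := by positivity
  -- The second `+ 1` keeps `r m < 1` at `m = 0`, so that `u m` stays positive.
  let r : ℕ → ℝ := fun m => 1 / ((m : ℝ) + 1 + 1)
  have hr0 : ∀ m, 0 < r m := fun m => by positivity
  have hr1 : ∀ m, r m < 1 := fun m => by
    show 1 / ((m : ℝ) + 1 + 1) < 1
    rw [div_lt_one (by positivity)]
    have : (0 : ℝ) ≤ m := by positivity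
    linarith
  have hr : Tendsto r atTop (𝓝 0) := by
    have := (tendsto_add_atTop_iff_nat 1).2 (tendsto_one_div_add_atTop_nhds_zero_nat (𝕜 := ℝ))
    simpa [r] using this
  let u : ℕ → ℝ := fun m => l * (1 - r m)
  let v : ℕ → ℝ := fun m => l * (1 + r m)
  have hu0 : ∀ m, 0 < u m := fun m => mul_pos hl (by linarith [hr1 m])
  have hul : ∀ m, u m < l := fun m => by
    show l * (1 - r m) < l
    nlinarith [hr0 m]
  have hvl : ∀ m, l < v m := fun m => by
    show l < l * (1 + r m)
    nlinarith [hr0 m]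
  have hv0 : ∀ m, 0 < v m := fun m => hl.trans (hvl m)
  have hut : Tendsto u atTop (𝓝 l) := by simpa using (hr.const_sub 1).const_mul l
  have hvt : Tendsto v atTop (𝓝 l) := by simpa using (hr.const_add 1).const_mul l
  have hridge : ∀ {ρ : ℝ}, 0 < ρ → _ := fun {ρ} hρ => ae_tendsto_ridge (ρ := ρ) hγ hn hmono hnp
    (fun k => (hM k).measurable_feature) hD hMP hη (hM 0).noise_mean hν_var hν
    (fun k => (hM k).linear) hρ
  -- Countably many ridge parameters suffice, so the exceptional null sets can be united.
  filter_upwards [ae_all_iff.2 fun m => hridge (hu0 m), ae_all_iff.2 fun m => hridge (hv0 m)]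
    with ω hωu hωv
  -- Strict monotonicity and `σ² > 0` leave a strict gap between the limit and the constraint level,
  -- which gives the inequality for large `k`.
  have hlow : ∀ m, ∀ᶠ k in atTop, ridgeTrain (P k).fst (φ k) (b k) (D k ω) (u m) ≤
      ridgeLoss (marchenkoPastur γ) l * σ ^ 2 := fun m =>
    ((hωu m).1.eventually (gt_mem_nhds (mul_lt_mul_of_pos_right
      (hmonoLoss (hu0 m) hl (hul m)) hσ2))).mono fun k hk => hk.le
  have hhigh : ∀ m, ∀ᶠ k in atTop, ridgeLoss (marchenkoPastur γ) l * σ ^ 2 ≤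
      ridgeTrain (P k).fst (φ k) (b k) (D k ω) (v m) := fun m =>
    ((hωv m).1.eventually (lt_mem_nhds (mul_lt_mul_of_pos_right
      (hmonoLoss hl (hv0 m) (hvl m)) hσ2))).mono fun k hk => hk.le
  have hcont := continuousAt_mpStieltjes_excess (γ := γ) hl
  refine ⟨(hlow 0).mono fun k hk => ?_, ?_⟩
  · obtain ⟨b', hb', -⟩ := (hM k).exists_feasible_ridge (D k ω) (hu0 0) hk
    exact ⟨b', hb'⟩
  · refine tendsto_of_sandwich
      (lo := fun m k => ((ridgeExcess (P k).fst (φ k) (b k) (D k ω) (v m) : ℝ) : EReal))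
      (hi := fun m k => ((ridgeExcess (P k).fst (φ k) (b k) (D k ω) (u m) : ℝ) : EReal))
      (fun m => ?_) (fun m => ?_)
      (fun m => (continuous_coe_real_ereal.tendsto _).comp (hωv m).2)
      (fun m => (continuous_coe_real_ereal.tendsto _).comp (hωu m).2)
      ((continuous_coe_real_ereal.tendsto _).comp ((hcont.tendsto.comp hvt).const_mul (σ ^ 2 * γ)))
      ((continuous_coe_real_ereal.tendsto _).comp ((hcont.tendsto.comp hut).const_mul (σ ^ 2 * γ)))
    · filter_upwards [hhigh m, hn.eventually_gt_atTop 0, hp.eventually_gt_atTop 0]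
        with k hk hnk hpk
      exact le_iInf₂ fun b' hb' => EReal.coe_le_coe_iff.2
        ((hM k).ridgeExcess_le (D k ω) (hv0 m) hnk hpk hk hb')
    · filter_upwards [hlow m] with k hk
      obtain ⟨b', hb', he⟩ := (hM k).exists_feasible_ridge (D k ω) (hu0 m) hk
      rw [← he]
      exact iInf₂_le b' hb'

end Asymptotics

end Overfit

/-! ### Assembly of the proposition -/

theorem mainTheorem2
    {Ω : Type*} [MeasurableSpace Ω] (μ : Measure Ω) [IsProbabilityMeasure μ]
    (n p d : ℕ → ℕ) (γ : ℝ) (hγ : 0 < γ)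
    (hn : Tendsto n atTop atTop) (hp : Tendsto p atTop atTop)
    (hmono : StrictMono n ∨ StrictMono p)
    (hnp : Tendsto (fun k => (n k : ℝ) / (p k : ℝ)) atTop (𝓝 γ))
    (P : (k : ℕ) → Measure ((Fin (d k) → ℝ) × ℝ)) [∀ k, IsProbabilityMeasure (P k)]
    (φ : (k : ℕ) → (Fin (d k) → ℝ) → Fin (p k) → ℝ)
    (hφ_meas : ∀ k, Measurable (φ k))
    (hφ_sq : ∀ k j, MemLp (fun x => φ k x j) 2 (P k).fst)
    (hφ_cov : ∀ k, (featureCov (P k).fst (φ k)).PosDef)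
    (D : (k : ℕ) → Ω → Fin (n k) → (Fin (d k) → ℝ) × ℝ)
    (hD : ∀ k, HasLaw (D k) (Measure.pi fun _ => P k) μ)
    (hMP : ∀ᵐ ω ∂μ, WeaklyConverges
      (fun k => esd (gram_isHermitian (P k).fst (φ k) (D k ω))) (marchenkoPastur γ))
    (ν : Measure ℝ) [IsProbabilityMeasure ν] (σ η : ℝ) (hη : 0 < η)
    (hν_mean : ∫ e, e ∂ν = 0) (hν_var : ∫ e, e ^ 2 ∂ν = σ ^ 2)
    (hν_mom : Integrable (fun e : ℝ => |e| ^ (4 + η)) ν)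
    (hLin : ∀ k, IsLinearModel (P k) (φ k) ν)
    (τ : ℝ) :
    (max 0 (1 - 1 / γ) < τ → τ < 1 →
      ∃! l : ℝ, 0 < l ∧ l ^ 2 * deriv (mpStieltjes γ) (-l) = τ) ∧
    ∀ l : ℝ, 0 < l → l ^ 2 * deriv (mpStieltjes γ) (-l) = τ →
      ∀ᵐ ω ∂μ,
        (∀ᶠ k in atTop, ∃ b ∈ feasible (φ k) σ τ (D k ω), ∀ b' ∈ feasible (φ k) σ τ (D k ω),
          excessLoss (P k) (linPred (φ k) b) ≤ excessLoss (P k) (linPred (φ k) b')) ∧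
        Tendsto (fun k => minExcessLoss (P k) (φ k) σ τ (D k ω)) atTop
          (𝓝 ((σ ^ 2 * γ *
            (mpStieltjes γ (-l) - l * deriv (mpStieltjes γ) (-l)) : ℝ) : EReal)) := by
  have hprob : IsProbabilityMeasure (marchenkoPastur γ) := by
    obtain ⟨ω, hω⟩ := hMP.exists
    exact isProbabilityMeasure_of_weaklyConverges_esd hn _ hω
  have hmp0 := marchenkoPastur_ae_nonneg γ
  have hν4 := integrable_pow_four_of_moment hη hν_mom
  have hν2 := integrable_sq_of_pow_four hν4
  choose b hb using hLin
  have hM : ∀ k, RegressionModel (P k) (φ k) ν (b k) := fun k =>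
    ⟨hφ_meas k, hφ_sq k, hφ_cov k, hb k, hν_mean, integrable_id_of_pow_four hν4, hν2⟩
  constructor
  · intro h0 h1
    rw [← marchenkoPastur_real_zero γ] at h0
    obtain ⟨l, hl, hlτ⟩ := exists_ridgeLoss_eq hmp0 h0 h1
    refine ⟨l, ⟨hl, by rw [sq_mul_deriv_mpStieltjes hl, hlτ]⟩, fun l' ⟨hl', hl'τ⟩ => ?_⟩
    rw [sq_mul_deriv_mpStieltjes hl', ← hlτ] at hl'τ
    exact (ridgeLoss_strictMonoOn hmp0 (h0.trans h1)).injOn hl' hl hl'τ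
  · intro l hl hτ
    rw [sq_mul_deriv_mpStieltjes hl] at hτ
    subst hτ
    -- Without noise the strict gap behind the sandwich vanishes; then almost surely the labels are
    -- exactly linear and the true coefficients attain excess loss 0.
    by_cases hσ : σ = 0
    · have hν0 : ∀ᵐ e ∂ν, e = 0 := by
        rw [hσ, zero_pow two_ne_zero,
          integral_eq_zero_iff_of_nonneg (fun e => sq_nonneg e) hν2] at hν_var
        filter_upwards [hν_var] with e he
        exact pow_eq_zero_iff two_ne_zero |>.1 he
      filter_upwards [ae_noise_eq_zero hφ_meas hD hb hν0] with ω hω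
      have hz := fun k => (hM k).minimizer_of_noise_eq_zero
        (τ := ridgeLoss (marchenkoPastur γ) l) (hω k) hσ
      have hmin : ∀ k, ∀ b' ∈ feasible (φ k) σ (ridgeLoss (marchenkoPastur γ) l) (D k ω),
          excessLoss (P k) (linPred (φ k) (b k)) ≤ excessLoss (P k) (linPred (φ k) b') :=
        fun k b' _ => by rw [(hz k).2]; exact (hM k).excessLoss_nonneg b'
      refine ⟨Eventually.of_forall fun k => ⟨b k, (hz k).1, hmin k⟩, ?_⟩
      have e : ∀ k, minExcessLoss (P k) (φ k) σ (ridgeLoss (marchenkoPastur γ) l) (D k ω) =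
          ((0 : ℝ) : EReal) := fun k => by
        rw [minExcessLoss_eq_of_isMin (hz k).1 (hmin k), (hz k).2]
      simp only [e]
      rw [hσ, zero_pow two_ne_zero, zero_mul, zero_mul]
      exact tendsto_const_nhds
    · filter_upwards [ae_tendsto_minExcessLoss hγ hn hp hmono hnp hM hD hMP hη hν_var hν_mom hσ hl]
        with ω hω
      exact ⟨hω.1.mono fun k hk => (hM k).exists_minimizer (D k ω) hk, hω.2⟩
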